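/- **Theorem 4.1 (Jacobi weights).** Let $\mu$ be a Borel probability measure on $\mathbb C$ whose support $K=\operatorname{supp}\mu$ is compact and non-polar. Let $I(\nu)=\iint\log\frac1{|z-w|}\,d\nu(z)\,d\nu(w)$ be the logarithmic energy, $\operatorname{Cap}(K)=\exp\bigl(-\inf_\nu I(\nu)\bigr)$ the logarithmic capacity (the infimum is over all Borel probability measures $\nu$ on $K$), and $\mu_K$ the equilibrium measure of $K$, i.e. the unique probability measure on $K$ of minimal energy. For $n\in\mathbb N=\{1,2,\dots\}$ define the Widom factor $$W_n^2(\mu)=\frac{\inf_{P}\bigl(\int|P|^2\,d\mu\bigr)^{1/2}}{\operatorname{Cap}(K)^n},$$ the infimum being over all monic polynomials $P$ of degree $n$, and let $$S(\mu)=\exp\Bigl[\int\log f\,d\mu_K\Bigr],$$ where $d\mu=f\,d\mu_K+d\mu_s$ is the Lebesgue decomposition of $\mu$ with respect to $\mu_K$ (and $S(\mu)=0$ if the integral is $-\infty$). For $\alpha,\beta>-1$ let $d\mu_{\alpha,\beta}(x)=c_{\alpha,\beta}(1-x)^\alpha(1+x)^\beta\chi_{[-1,1]}(x)\,dx$, where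 $c_{\alpha,\beta}>0$ is such that $\mu_{\alpha,\beta}([-1,1])=1$. For all $\alpha,\beta>-1$ we have $$\bigl[W_n^2(\mu_{\alpha,\beta})\bigr]^2\ge L_{\alpha,\beta}\,S(\mu_{\alpha,\beta}),\qquad n\in\mathbb N,$$ where $$L_{\alpha,\beta}=\min\left\{2,\ \frac{2^{2\alpha+2\beta+6}}{\pi(\alpha+\beta+3)}\,\frac{\Gamma(\alpha+2)\Gamma(\beta+2)\Gamma(\alpha+\beta+2)}{\Gamma(\alpha+\beta+3)^2}\right\},$$ and this constant is optimal: if $C\in\mathbb R$ satisfies $\bigl[W_n^2(\mu_{\alpha,\beta})\bigr]^2\ge C\,S(\mu_{\alpha,\beta})$ for all $n\in\mathbb N$, then $C\le L_{\alpha,\beta}$. In addition, if $\alpha^2+\beta^2\le\frac12$ and $|\alpha|+|\beta|<1$, then $L_{\alpha,\beta}<2$; and if $|\alpha|+|\beta|\ge1$ or $\alpha^2+\beta^2>4-2\sqrt3$, then $L_{\alpha,\beta}=2$, that is, $\bigl[W_n^2(\mu_{\alpha,\beta})\bigr]^2\ge2S(\mu_{\alpha,\beta})$ for all $n\in\mathbb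 N$. In particular, in the symmetric case $\alpha=\beta$, the inequality $\bigl[W_n^2(\mu_{\alpha,\alpha})\bigr]^2\ge2S(\mu_{\alpha,\alpha})$ holds for all $n\in\mathbb N$ if and only if $|\alpha|\ge\frac12$. -/

import Mathlib

open MeasureTheory Polynomial
open scoped ENNReal

noncomputable section

namespace Widom

/-- The integral `∫ g dν` of an extended real valued function, as the integral of the positive part
minus the integral of the negative part. It has its usual meaning, with values in `[-∞, ∞]`, as soon
as one of the two parts has a finite integral. -/
def extIntegral {X : Type*} [MeasurableSpace X] (ν : Measure X) (g : X → EReal) : EReal :=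
  ((∫⁻ x, (g x).toENNReal ∂ν : ℝ≥0∞) : EReal) - ((∫⁻ x, (-g x).toENNReal ∂ν : ℝ≥0∞) : EReal)

/-- The logarithmic energy `∬ log (1 / |z - w|) dν(z) dν(w)`. Here `ENNReal.log 0 = ⊥`, so the
kernel is `+∞` on the diagonal. -/
def energy (ν : Measure ℂ) : EReal :=
  extIntegral (ν.prod ν) (fun q : ℂ × ℂ => -ENNReal.log ‖q.1 - q.2‖ₑ)

/-- The Borel probability measures carried by the set `K`. -/
def probabilityOn (K : Set ℂ) : Set (Measure ℂ) :=
  {ν | IsProbabilityMeasure ν ∧ ν Kᶜ = 0}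

/-- The logarithmic capacity of a compact set: `exp (- inf I(ν))`, the infimum of the logarithmic
energy being over the probability measures on `K`. -/
def capacity (K : Set ℂ) : ℝ :=
  (EReal.exp (-⨅ ν ∈ probabilityOn K, energy ν)).toReal

/-- `ν` is an equilibrium measure of the compact set `K`: a probability measure on `K` of minimal
logarithmic energy. -/
def IsEquilibriumMeasure (K : Set ℂ) (ν : Measure ℂ) : Prop :=
  ν ∈ probabilityOn K ∧ ∀ ν' ∈ probabilityOn K, energy ν ≤ energy ν'

open Classical in
/-- The equilibrium measure of `K` (it exists and is unique if `K` is compact and non-polar). -/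
def equilibriumMeasure (K : Set ℂ) : Measure ℂ :=
  if h : ∃ ν, IsEquilibriumMeasure K ν then h.choose else 0

/-- The exponential relative entropy `S(μ) = exp ∫ log f dμ_K`, where `μ_K` is the equilibrium
measure of `K = supp μ` and `f` is the density of the absolutely continuous part of `μ` with respect
to `μ_K`. The integral may be `-∞`, and then `S(μ) = 0`. -/
def entropyExp (μ : Measure ℂ) : ℝ :=
  (EReal.exp (extIntegral (equilibriumMeasure μ.support)
    (fun z => ENNReal.log (μ.rnDeriv (equilibriumMeasure μ.support) z)))).toReal

/-- The Widom factor `W_n^p(μ)`: the infimum of the `L^p(μ)` norms of the monic polynomials of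
degree `n`, divided by the `n`-th power of the capacity of `supp μ`. -/
def widomFactor (p : ℝ≥0∞) (n : ℕ) (μ : Measure ℂ) : ℝ :=
  (⨅ P : {P : ℂ[X] // P.Monic ∧ P.natDegree = n}, (eLpNorm (fun z => P.1.eval z) p μ).toReal)
    / capacity μ.support ^ n

/-- The weight `(1 - x)^α (1 + x)^β`. -/
def jacobiWeight (α β x : ℝ) : ℝ := (1 - x) ^ α * (1 + x) ^ β

/-- The normalization constant `c_{α,β}`. -/
def jacobiNormalization (α β : ℝ) : ℝ := (∫ x in Set.Icc (-1 : ℝ) 1, jacobiWeight α β x)⁻¹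

/-- The normalized Jacobi measure `c_{α,β} (1 - x)^α (1 + x)^β dx` on `[-1, 1]`, as a measure on
the complex plane. -/
def jacobiMeasure (α β : ℝ) : Measure ℂ :=
  Measure.map (fun x : ℝ => (x : ℂ))
    ((volume.restrict (Set.Icc (-1 : ℝ) 1)).withDensity
      (fun x => ENNReal.ofReal (jacobiNormalization α β * jacobiWeight α β x)))

/-- The constant `L_{α,β}`. -/
def jacobiL (α β : ℝ) : ℝ :=
  min 2 ((2 : ℝ) ^ (2 * α + 2 * β + 6) / (Real.pi * (α + β + 3)) *
    (Real.Gamma (α + 2) * Real.Gamma (β + 2) * Real.Gamma (α + β + 2)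
      / Real.Gamma (α + β + 3) ^ 2))

end Widom

end

namespace Widom

open Filter Topology

/-! ### Extended-real integrals. -/

section ExtIntegral

variable {X : Type*} [MeasurableSpace X] {ν : Measure X}

/-! Every quantity in the inequality is explicit, so the theorem reduces to the behaviour of one
sequence of Gamma quotients.

Potential theory: formally `-log |x - y| = log 2 + ∑ (2/k) T_k(x) T_k(y)` on `[-1, 1]`, so the
energy of `ν` is `log 2` plus a weighted sum of squares of its Chebyshev moments. Abel summation
yields the inequality that is needed (`log_two_add_le_realEnergy`). The arcsine law attains `log 2`,
and it is the only minimiser because vanishing Chebyshev moments determine the measure. Hence the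
capacity is `1/2`, and the entropy follows from the value `-log 2` of `∫ log |x - y|` against the
arcsine law at `y = ±1` (`entropyExp_jacobiMeasure`).

Extremal polynomials: the monic Jacobi polynomials minimise the norm. Their norms come from
integration by parts, which trades one degree for a unit increase of both parameters
(`exists_monic_jacobi`). The squared Widom factor divided by the entropy is then `widomRatio`.

Monotonicity: put `s = α + β`, `d = α - β`, `t = 2n + s + 2`. The sign of the increment of the ratio
at `n` is that of `s²d² - (s² + d² - 1)t²`. Once this is nonpositive it stays so, hence the sequence
first increases and then decreases, either phase possibly being absent. Its limit is 2, by Gamma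
asymptotics and the Wallis product. Its infimum is therefore the smaller of 2 and its value at `n =
1`, which is `jacobiL`. The remaining claims read off the sign of the increment (`jacobiL_lt_two`,
`jacobiL_eq_two`). -/

theorem extIntegral_congr_ae {g h : X → EReal} (hgh : g =ᵐ[ν] h) :
    extIntegral ν g = extIntegral ν h := by
  unfold extIntegral
  congr 2
  · exact lintegral_congr_ae (hgh.mono fun x hx => by simp only [hx])
  · exact lintegral_congr_ae (hgh.mono fun x hx => by simp only [hx])

theorem extIntegral_mono_ae {g h : X → EReal} (hgh : g ≤ᵐ[ν] h) :
    extIntegral ν g ≤ extIntegral ν h := by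
  refine EReal.sub_le_sub ?_ ?_
  · exact EReal.coe_ennreal_le_coe_ennreal_iff.2
      (lintegral_mono_ae (hgh.mono fun x hx => EReal.toENNReal_le_toENNReal hx))
  · exact EReal.coe_ennreal_le_coe_ennreal_iff.2
      (lintegral_mono_ae (hgh.mono fun x hx =>
        EReal.toENNReal_le_toENNReal (EReal.neg_le_neg_iff.2 hx)))

theorem extIntegral_coe {h : X → ℝ} (hh : Integrable h ν) :
    extIntegral ν (fun x => (h x : EReal)) = ((∫ x, h x ∂ν : ℝ) : EReal) := by
  have h1 : ∫⁻ x, ENNReal.ofReal (h x) ∂ν ≠ ⊤ := hh.lintegral_lt_top.ne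
  have h2 : ∫⁻ x, ENNReal.ofReal (-h x) ∂ν ≠ ⊤ := hh.neg.lintegral_lt_top.ne
  rw [integral_eq_lintegral_pos_part_sub_lintegral_neg_part hh, EReal.coe_sub,
    EReal.coe_ennreal_toReal h1, EReal.coe_ennreal_toReal h2]
  rfl

end ExtIntegral
-- The arcsine law and its logarithmic potential.
section Arcsine

theorem integral_log_norm_circleMap_sub {a : ℂ} (ha : ‖a‖ = 1) :
    ∫ θ in 0..2 * Real.pi, Real.log ‖circleMap 0 1 θ - a‖ = 0 := by
  have h := circleAverage_log_norm_sub_const_eq_posLog (a := a)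
  rw [Real.circleAverage_def, ha] at h
  simpa [Real.pi_ne_zero] using h

/-- Fold the circle onto the interval: for `a = e^{iφ}`, `|e^{iθ} - a| |e^{-iθ} - a| = 2 |cos θ -
cos φ|`. The half-circle integral of the logarithm of this product is the full-circle integral of
`log |z - a|`, which vanishes. -/
theorem integral_log_abs_cos_sub_cos (φ : ℝ) :
    ∫ θ in 0..Real.pi, Real.log |Real.cos θ - Real.cos φ| = -(Real.pi * Real.log 2) := by
  set a : ℂ := circleMap 0 1 φ with ha
  set f : ℝ → ℝ := fun θ => Real.log ‖circleMap 0 1 θ - a‖ with hf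
  have hper : Function.Periodic f (2 * Real.pi) := fun θ => by
    simp only [hf, periodic_circleMap 0 1 θ]
  have hint : IntervalIntegrable f volume 0 (2 * Real.pi) :=
    circleIntegrable_log_norm_sub_const 1
  have hint' : ∀ s t, IntervalIntegrable f volume s t := fun s t =>
    hper.intervalIntegrable₀ Real.two_pi_pos.ne' hint s t
  have h0 : ∫ θ in (-Real.pi)..Real.pi, f θ = 0 := by
    have h1 := hper.intervalIntegral_add_eq (-Real.pi) 0
    rw [show -Real.pi + 2 * Real.pi = Real.pi by ring, zero_add] at h1
    rw [h1]
    exact integral_log_norm_circleMap_sub (by simp [ha])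
  rw [← intervalIntegral.integral_add_adjacent_intervals (hint' _ 0) (hint' 0 _)] at h0
  have h2 : ∫ θ in (-Real.pi)..0, f θ = ∫ θ in 0..Real.pi, f (-θ) := by
    rw [intervalIntegral.integral_comp_neg]; simp
  have hi2 : IntervalIntegrable (fun θ => f (-θ)) volume 0 Real.pi := by
    simpa using (IntervalIntegrable.iff_comp_neg (f := f)).1 (hint' (-0) (-Real.pi))
  rw [h2, ← intervalIntegral.integral_add hi2 (hint' _ _)] at h0
  have key : ∀ θ : ℝ, ‖circleMap 0 1 (-θ) - a‖ * ‖circleMap 0 1 θ - a‖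
      = 2 * |Real.cos θ - Real.cos φ| := by
    intro θ
    rw [← norm_mul]
    have : (circleMap 0 1 (-θ) - a) * (circleMap 0 1 θ - a)
        = (-2 * a) * ((Real.cos θ - Real.cos φ : ℝ) : ℂ) := by
      have e1 : Complex.exp (-(θ * Complex.I)) * Complex.exp (θ * Complex.I) = 1 := by
        rw [← Complex.exp_add]; simp
      have e2 : Complex.exp (-(φ * Complex.I)) * Complex.exp (φ * Complex.I) = 1 := by
        rw [← Complex.exp_add]; simp
      simp only [ha, circleMap, Complex.ofReal_sub, Complex.ofReal_cos, Complex.cos,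
        Complex.ofReal_neg, Complex.ofReal_one, one_mul, zero_add, neg_mul]
      linear_combination e1 - e2
    rw [this, norm_mul, norm_mul, Complex.norm_real]
    simp [ha]
  have hne : ∀ᵐ θ : ℝ, Real.cos θ - Real.cos φ ≠ 0 := by
    have hc : {θ : ℝ | Real.cos θ - Real.cos φ = 0}.Countable := by
      have : {θ : ℝ | Real.cos θ - Real.cos φ = 0} ⊆
          Set.range (fun k : ℤ => 2 * k * Real.pi + φ) ∪
          Set.range (fun k : ℤ => 2 * k * Real.pi - φ) := by
        intro θ hθ
        obtain ⟨k, hk⟩ := Real.cos_eq_cos_iff.1 (sub_eq_zero.1 hθ).symm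
        rcases hk with hk | hk
        · exact Or.inl ⟨k, hk.symm⟩
        · exact Or.inr ⟨k, hk.symm⟩
      exact ((Set.countable_range _).union (Set.countable_range _)).mono this
    simpa [ae_iff] using hc.measure_zero volume
  have hpt : ∀ θ : ℝ, Real.cos θ - Real.cos φ ≠ 0 →
      Real.log 2 + Real.log |Real.cos θ - Real.cos φ| = f (-θ) + f θ := by
    intro θ hθ
    have hk := key θ
    have hp : 0 < 2 * |Real.cos θ - Real.cos φ| := by positivity
    rw [← Real.log_mul two_ne_zero (abs_pos.2 hθ).ne', ← hk]
    rw [← hk] at hp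
    simp only [hf]
    rw [Real.log_mul (left_ne_zero_of_mul hp.ne') (right_ne_zero_of_mul hp.ne')]
  have h3 : ∫ θ in 0..Real.pi, (f (-θ) + f θ) =
      ∫ θ in 0..Real.pi, (Real.log 2 + Real.log |Real.cos θ - Real.cos φ|) := by
    refine intervalIntegral.integral_congr_ae (hne.mono fun θ hθ _ => ?_)
    exact (hpt θ hθ).symm
  have hi3 : IntervalIntegrable (fun θ => Real.log |Real.cos θ - Real.cos φ|) volume 0 Real.pi := by
    have := (hi2.add (hint' 0 Real.pi)).sub (intervalIntegrable_const (c := Real.log 2))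
    refine this.congr_ae ?_
    refine ae_restrict_of_ae (hne.mono fun θ hθ => ?_)
    change f (-θ) + f θ - Real.log 2 = _
    linarith [hpt θ hθ]
  rw [h3, intervalIntegral.integral_add intervalIntegrable_const hi3] at h0
  simp only [intervalIntegral.integral_const, sub_zero, smul_eq_mul] at h0
  linarith

/-- The arcsine distribution on `[-1, 1]`. -/
noncomputable def arcsine : Measure ℝ :=
  ENNReal.ofReal Real.pi⁻¹ • Polynomial.Chebyshev.measureT

theorem integral_arcsine (f : ℝ → ℝ) :
    ∫ x, f x ∂arcsine = Real.pi⁻¹ * ∫ θ in 0..Real.pi, f (Real.cos θ) := by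
  rw [arcsine, integral_smul_measure, Polynomial.Chebyshev.integral_measureT_eq_integral_cos,
    ENNReal.toReal_ofReal (by positivity), smul_eq_mul]

instance : IsProbabilityMeasure arcsine := by
  have h1 : Integrable (fun _ : ℝ => (1 : ℝ)) Polynomial.Chebyshev.measureT :=
    Polynomial.Chebyshev.integrable_measureT continuousOn_const
  have : IsFiniteMeasure Polynomial.Chebyshev.measureT :=
    (integrable_const_iff_isFiniteMeasure one_ne_zero).1 h1
  have : IsFiniteMeasure arcsine := Measure.smul_finite _ ENNReal.ofReal_ne_top
  have h := integral_arcsine (fun _ => 1)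
  simp only [integral_const, smul_eq_mul, mul_one, intervalIntegral.integral_const, sub_zero,
    inv_mul_cancel₀ Real.pi_ne_zero] at h
  constructor
  rw [← ENNReal.ofReal_toReal (measure_ne_top arcsine Set.univ)]
  simp only [Measure.real] at h
  simp [h]

theorem arcsine_compl_Ioc : arcsine (Set.Ioc (-1) 1)ᶜ = 0 := by
  rw [arcsine, Measure.smul_apply, Polynomial.Chebyshev.measureT,
    Measure.restrict_apply measurableSet_Ioc.compl]
  simp

theorem arcsine_absolutelyContinuous : arcsine ≪ volume := by
  unfold arcsine Polynomial.Chebyshev.measureT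
  exact (Measure.smul_absolutelyContinuous.trans Measure.absolutelyContinuous_restrict).trans
    (withDensity_absolutelyContinuous _ _)

theorem arcsine_ae_mem : ∀ᵐ x ∂arcsine, x ∈ Set.Ioo (-1 : ℝ) 1 := by
  have h1 : ∀ᵐ x ∂arcsine, x ∈ Set.Ioc (-1 : ℝ) 1 := arcsine_compl_Ioc
  have h2 : ∀ᵐ x ∂arcsine, x ≠ (1 : ℝ) :=
    arcsine_absolutelyContinuous.ae_le (Measure.ae_ne volume (1 : ℝ))
  filter_upwards [h1, h2] with x hx hx'
  exact ⟨hx.1, lt_of_le_of_ne hx.2 hx'⟩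

theorem integral_log_abs_sub_arcsine {y : ℝ} (hy : y ∈ Set.Icc (-1 : ℝ) 1) :
    ∫ x, Real.log |x - y| ∂arcsine = -Real.log 2 := by
  rw [integral_arcsine, ← Real.cos_arccos hy.1 hy.2, integral_log_abs_cos_sub_cos]
  field_simp

theorem integrable_log_abs_sub_arcsine {y : ℝ} (hy : y ∈ Set.Icc (-1 : ℝ) 1) :
    Integrable (fun x => Real.log |x - y|) arcsine := by
  -- A non-integrable function has Bochner integral 0, so the nonzero value `-log 2` already gives
  -- integrability.
  apply Integrable.of_integral_ne_zero
  rw [integral_log_abs_sub_arcsine hy]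
  exact neg_ne_zero.2 (Real.log_pos one_lt_two).ne'

theorem integral_eval_chebyshev_arcsine {n : ℤ} (hn : n ≠ 0) :
    ∫ x, (Polynomial.Chebyshev.T ℝ n).eval x ∂arcsine = 0 := by
  rw [arcsine, integral_smul_measure,
    Polynomial.Chebyshev.integral_eval_T_real_measureT_of_ne_zero hn, smul_zero]

end Arcsine

/-! ### Abel means of the Chebyshev expansion of the logarithmic kernel. -/

section Kernel

/-- The product `|1 - r e^{i(θ + φ)}| |1 - r e^{i(θ - φ)}|`. -/
noncomputable def poissonProduct (r θ φ : ℝ) : ℝ :=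
  ‖1 - (r : ℂ) * Complex.exp ((θ + φ : ℝ) * Complex.I)‖ *
    ‖1 - (r : ℂ) * Complex.exp ((θ - φ : ℝ) * Complex.I)‖

theorem normSq_one_sub_mul_exp (r a : ℝ) :
    ‖1 - (r : ℂ) * Complex.exp ((a : ℝ) * Complex.I)‖ ^ 2
      = (1 - r) ^ 2 + 2 * r * (1 - Real.cos a) := by
  rw [← Complex.normSq_eq_norm_sq, Complex.normSq_apply]
  have h1 : (1 - (r : ℂ) * Complex.exp ((a : ℝ) * Complex.I)).re = 1 - r * Real.cos a := by
    simp [Complex.exp_ofReal_mul_I_re]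
  have h2 : (1 - (r : ℂ) * Complex.exp ((a : ℝ) * Complex.I)).im = - (r * Real.sin a) := by
    simp [Complex.exp_ofReal_mul_I_im]
  rw [h1, h2]
  linear_combination r ^ 2 * Real.sin_sq_add_cos_sq a

/-- Drop `(1 - r)²` from each squared factor and use `(1 - cos (θ + φ))(1 - cos (θ - φ)) = (cos θ -
cos φ)²`. This bounds the singular kernel below by a bounded one. -/
theorem two_mul_abs_cos_sub_cos_le_poissonProduct {r : ℝ} (hr : 0 ≤ r) (θ φ : ℝ) :
    2 * r * |Real.cos θ - Real.cos φ| ≤ poissonProduct r θ φ := by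
  refine abs_le_of_sq_le_sq' ?_ (by unfold poissonProduct; positivity) |>.2
  rw [poissonProduct, mul_pow (2 * r), mul_pow ‖_‖, normSq_one_sub_mul_exp, normSq_one_sub_mul_exp, sq_abs]
  have e : (1 - Real.cos (θ + φ)) * (1 - Real.cos (θ - φ)) = (Real.cos θ - Real.cos φ) ^ 2 := by
    rw [Real.cos_add, Real.cos_sub]
    linear_combination -(1 - Real.cos φ ^ 2) * Real.sin_sq_add_cos_sq θ
      - (Real.sin θ ^ 2) * Real.sin_sq_add_cos_sq φ
  have ha : 0 ≤ 2 * r * (1 - Real.cos (θ + φ)) :=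
    mul_nonneg (by positivity) (sub_nonneg.2 (Real.cos_le_one _))
  have hb : 0 ≤ 2 * r * (1 - Real.cos (θ - φ)) :=
    mul_nonneg (by positivity) (sub_nonneg.2 (Real.cos_le_one _))
  calc (2 * r) ^ 2 * (Real.cos θ - Real.cos φ) ^ 2
      = (2 * r * (1 - Real.cos (θ + φ))) * (2 * r * (1 - Real.cos (θ - φ))) := by rw [← e]; ring
    _ ≤ _ := mul_le_mul (by nlinarith [sq_nonneg (1 - r)]) (by nlinarith [sq_nonneg (1 - r)]) hb
        (by positivity)

theorem norm_mul_exp_lt_one {r : ℝ} (hr : 0 ≤ r) (hr1 : r < 1) (a : ℝ) :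
    ‖(r : ℂ) * Complex.exp ((a : ℝ) * Complex.I)‖ < 1 := by
  rw [norm_mul, Complex.norm_exp_ofReal_mul_I, Complex.norm_real, mul_one, Real.norm_eq_abs,
    abs_of_nonneg hr]
  exact hr1

/-- Real part of the Taylor series of `-log (1 - z)` at `z = r e^{ia}`. The term `k = 0` is zero
because division by zero gives zero. -/
theorem hasSum_neg_log_norm {r : ℝ} (hr : 0 ≤ r) (hr1 : r < 1) (a : ℝ) :
    HasSum (fun k : ℕ => r ^ k / k * Real.cos (k * a))
      (-Real.log ‖1 - (r : ℂ) * Complex.exp ((a : ℝ) * Complex.I)‖) := by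
  have h := Complex.hasSum_re
    (Complex.hasSum_taylorSeries_neg_log (norm_mul_exp_lt_one hr hr1 a))
  rw [Complex.neg_re, Complex.log_re] at h
  convert! h using 2 with k
  rw [mul_pow, ← Complex.exp_nat_mul, ← mul_assoc, ← Complex.ofReal_natCast, ← Complex.ofReal_mul,
    ← Complex.ofReal_pow, mul_div_right_comm, ← Complex.ofReal_div, Complex.re_ofReal_mul,
    Complex.exp_ofReal_mul_I_re]

theorem hasSum_cos_mul_cos {r : ℝ} (hr : 0 ≤ r) (hr1 : r < 1) (θ φ : ℝ) :
    HasSum (fun k : ℕ => 2 / k * r ^ k * (Real.cos (k * θ) * Real.cos (k * φ)))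
      (-Real.log (poissonProduct r θ φ)) := by
  have hne : ∀ a : ℝ, ‖1 - (r : ℂ) * Complex.exp ((a : ℝ) * Complex.I)‖ ≠ 0 := by
    intro a h
    have h1 := norm_mul_exp_lt_one hr hr1 a
    rw [← sub_eq_zero.1 (norm_eq_zero.1 h)] at h1
    simp at h1
  rw [poissonProduct, Real.log_mul (hne _) (hne _), neg_add]
  convert! (hasSum_neg_log_norm hr hr1 (θ + φ)).add (hasSum_neg_log_norm hr hr1 (θ - φ)) using 2
    with k
  rw [mul_add, mul_sub, Real.cos_add, Real.cos_sub]
  ring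

/-- The Abel means of the expansion of the logarithmic kernel in Chebyshev polynomials. -/
noncomputable def abelKernel (r : ℝ) (q : ℝ × ℝ) : ℝ :=
  -Real.log (poissonProduct r (Real.arccos q.1) (Real.arccos q.2))

theorem measurable_abelKernel (r : ℝ) : Measurable (abelKernel r) := by
  have : Continuous fun q : ℝ × ℝ => poissonProduct r (Real.arccos q.1) (Real.arccos q.2) := by
    unfold poissonProduct
    fun_prop
  exact (Real.measurable_log.comp this.measurable).neg

theorem hasSum_abelKernel {r : ℝ} (hr : 0 ≤ r) (hr1 : r < 1) {x y : ℝ}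
    (hx : x ∈ Set.Icc (-1 : ℝ) 1) (hy : y ∈ Set.Icc (-1 : ℝ) 1) :
    HasSum (fun k : ℕ => 2 / k * r ^ k * ((Chebyshev.T ℝ k).eval x * (Chebyshev.T ℝ k).eval y))
      (abelKernel r (x, y)) := by
  have h := hasSum_cos_mul_cos hr hr1 (Real.arccos x) (Real.arccos y)
  convert! h using 5 with k
  · conv_lhs => rw [← Real.cos_arccos hx.1 hx.2, Chebyshev.T_real_cos]
    norm_cast
  · conv_lhs => rw [← Real.cos_arccos hy.1 hy.2, Chebyshev.T_real_cos]
    norm_cast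

theorem abelKernel_le {r : ℝ} (hr : 0 < r) {x y : ℝ} (hx : x ∈ Set.Icc (-1 : ℝ) 1)
    (hy : y ∈ Set.Icc (-1 : ℝ) 1) (hxy : x ≠ y) :
    Real.log 2 + Real.log r + abelKernel r (x, y) ≤ -Real.log |x - y| := by
  have h := two_mul_abs_cos_sub_cos_le_poissonProduct hr.le (Real.arccos x) (Real.arccos y)
  rw [Real.cos_arccos hx.1 hx.2, Real.cos_arccos hy.1 hy.2] at h
  have hp : 0 < |x - y| := abs_pos.2 (sub_ne_zero.2 hxy)
  have h2 := Real.log_le_log (by positivity) h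
  rw [Real.log_mul (by positivity) hp.ne', Real.log_mul two_ne_zero hr.ne'] at h2
  simp only [abelKernel]
  linarith

theorem abs_eval_chebyshev_le_one {x : ℝ} (hx : x ∈ Set.Icc (-1 : ℝ) 1) (k : ℤ) :
    |(Chebyshev.T ℝ k).eval x| ≤ 1 := by
  rw [← Real.cos_arccos hx.1 hx.2, Chebyshev.T_real_cos]
  exact Real.abs_cos_le_one _

theorem norm_chebyshev_coeff_le {r : ℝ} (hr : 0 ≤ r) {x y : ℝ}
    (hx : x ∈ Set.Icc (-1 : ℝ) 1) (hy : y ∈ Set.Icc (-1 : ℝ) 1) (k : ℕ) :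
    ‖2 / k * r ^ k * ((Chebyshev.T ℝ k).eval x * (Chebyshev.T ℝ k).eval y)‖ ≤ 2 * r ^ k := by
  have h1 := abs_eval_chebyshev_le_one hx k
  have h2 := abs_eval_chebyshev_le_one hy k
  have h3 : |(2 : ℝ) / k| ≤ 2 := by
    rw [abs_of_nonneg (by positivity)]
    rcases Nat.eq_zero_or_pos k with rfl | hk
    · simp
    · exact div_le_self (by norm_num) (by exact_mod_cast hk)
  rw [Real.norm_eq_abs, abs_mul, abs_mul, abs_mul, abs_of_nonneg (pow_nonneg hr k)]
  calc |(2 : ℝ) / k| * r ^ k * (|(Chebyshev.T ℝ k).eval x| * |(Chebyshev.T ℝ k).eval y|)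
      ≤ 2 * r ^ k * (1 * 1) := by gcongr
    _ = 2 * r ^ k := by ring

end Kernel

/-! ### Minimising the energy on the real interval. -/

section Energy

theorem logKernel_eq (x y : ℝ) :
    (-ENNReal.log ‖x - y‖ₑ) = if x = y then ⊤ else ((-Real.log |x - y| : ℝ) : EReal) := by
  split_ifs with h
  · simp [h]
  · rw [Real.enorm_eq_ofReal_abs, ENNReal.log_ofReal_of_pos (abs_pos.2 (sub_ne_zero.2 h))]
    rfl

variable {ν : Measure ℝ}

theorem ae_prod_mem_Icc [IsProbabilityMeasure ν] (hν : ∀ᵐ x ∂ν, x ∈ Set.Icc (-1 : ℝ) 1) :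
    ∀ᵐ q ∂(ν.prod ν), q.1 ∈ Set.Icc (-1 : ℝ) 1 ∧ q.2 ∈ Set.Icc (-1 : ℝ) 1 :=
  (Measure.quasiMeasurePreserving_fst.ae hν).and (Measure.quasiMeasurePreserving_snd.ae hν)

theorem integrable_eval_of_ae_mem_Icc [IsFiniteMeasure ν] (hν : ∀ᵐ x ∂ν, x ∈ Set.Icc (-1 : ℝ) 1)
    {f : ℝ → ℝ} (hf : Continuous f) : Integrable f ν := by
  obtain ⟨C, hC⟩ := isCompact_Icc.exists_bound_of_continuousOn
    (s := Set.Icc (-1 : ℝ) 1) hf.continuousOn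
  exact Integrable.of_bound hf.aestronglyMeasurable C (hν.mono hC)

theorem integrable_abelKernel [IsProbabilityMeasure ν] (hν : ∀ᵐ x ∂ν, x ∈ Set.Icc (-1 : ℝ) 1)
    {r : ℝ} (hr : 0 ≤ r) (hr1 : r < 1) : Integrable (abelKernel r) (ν.prod ν) := by
  refine Integrable.of_bound (measurable_abelKernel r).aestronglyMeasurable
    (2 * (1 - r)⁻¹) ((ae_prod_mem_Icc hν).mono fun q hq => ?_)
  rw [← (hasSum_abelKernel hr hr1 hq.1 hq.2).tsum_eq]
  exact tsum_of_norm_bounded ((hasSum_geometric_of_lt_one hr hr1).mul_left 2)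
    (norm_chebyshev_coeff_le hr hq.1 hq.2)

/-- Termwise integration turns the kernel into a series of nonnegative multiples of squared
Chebyshev moments; a single term is kept. -/
theorem le_integral_abelKernel [IsProbabilityMeasure ν] (hν : ∀ᵐ x ∂ν, x ∈ Set.Icc (-1 : ℝ) 1)
    {r : ℝ} (hr : 0 ≤ r) (hr1 : r < 1) (k : ℕ) :
    2 / k * r ^ k * (∫ x, (Chebyshev.T ℝ k).eval x ∂ν) ^ 2 ≤ ∫ q, abelKernel r q ∂(ν.prod ν) := by
  set F : ℕ → ℝ × ℝ → ℝ := fun k q =>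
    2 / k * r ^ k * ((Chebyshev.T ℝ k).eval q.1 * (Chebyshev.T ℝ k).eval q.2) with hF
  have hT : ∀ k : ℕ, Integrable (fun x => (Chebyshev.T ℝ k).eval x) ν := fun k =>
    integrable_eval_of_ae_mem_Icc hν (Polynomial.continuous _)
  have hFi : ∀ k, Integrable (F k) (ν.prod ν) := fun k => ((hT k).mul_prod (hT k)).const_mul _
  have hsum : Summable fun k => ∫ q, ‖F k q‖ ∂(ν.prod ν) := by
    refine Summable.of_nonneg_of_le (fun k => integral_nonneg fun q => norm_nonneg _) (fun k => ?_)
      ((summable_geometric_of_lt_one hr hr1).mul_left 2)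
    calc ∫ q, ‖F k q‖ ∂(ν.prod ν) ≤ ∫ q, 2 * r ^ k ∂(ν.prod ν) :=
          integral_mono_ae (hFi k).norm (integrable_const _)
            ((ae_prod_mem_Icc hν).mono fun q hq => norm_chebyshev_coeff_le hr hq.1 hq.2 k)
      _ = 2 * r ^ k := by simp
  have h := hasSum_integral_of_summable_integral_norm hFi hsum
  have hint : ∀ k, ∫ q, F k q ∂(ν.prod ν)
      = 2 / k * r ^ k * (∫ x, (Chebyshev.T ℝ k).eval x ∂ν) ^ 2 := by
    intro k
    simp only [hF]
    rw [integral_const_mul, integral_prod_mul (fun x => (Chebyshev.T ℝ k).eval x)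
      (fun x => (Chebyshev.T ℝ k).eval x), sq]
  have hE : ∫ q, ∑' k, F k q ∂(ν.prod ν) = ∫ q, abelKernel r q ∂(ν.prod ν) :=
    integral_congr_ae ((ae_prod_mem_Icc hν).mono fun q hq =>
      (hasSum_abelKernel hr hr1 hq.1 hq.2).tsum_eq)
  rw [hE] at h
  rw [← hint k]
  exact le_hasSum h k fun j _ => by rw [hint j]; positivity

/-- The logarithmic energy of a measure on the real line. -/
noncomputable def realEnergy (ν : Measure ℝ) : EReal :=
  extIntegral (ν.prod ν) (fun q : ℝ × ℝ => -ENNReal.log ‖q.1 - q.2‖ₑ)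

theorem measurable_logKernel :
    Measurable fun q : ℂ × ℂ => -ENNReal.log ‖q.1 - q.2‖ₑ := by
  refine (ENNReal.measurable_log.comp ?_).neg
  fun_prop

theorem energy_map_ofReal (ν : Measure ℝ) [SFinite ν] :
    energy (ν.map (fun x : ℝ => (x : ℂ))) = realEnergy ν := by
  have hm : Measurable fun x : ℝ => (x : ℂ) := Complex.measurable_ofReal
  have hk := measurable_logKernel
  have hk' : Measurable fun q : ℂ × ℂ => - -ENNReal.log ‖q.1 - q.2‖ₑ := hk.neg
  have e : ∀ q : ℝ × ℝ, ‖((q.1 : ℂ) - (q.2 : ℂ))‖ₑ = ‖q.1 - q.2‖ₑ := fun q => by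
    rw [← Complex.ofReal_sub, ← ofReal_norm, ← ofReal_norm, Complex.norm_real]
  unfold energy realEnergy extIntegral
  rw [Measure.map_prod_map _ _ hm hm, lintegral_map hk.ereal_toENNReal (hm.prodMap hm),
    lintegral_map hk'.ereal_toENNReal (hm.prodMap hm)]
  simp only [Prod.map_fst, Prod.map_snd, e]

theorem le_realEnergy [IsProbabilityMeasure ν] (hν : ∀ᵐ x ∂ν, x ∈ Set.Icc (-1 : ℝ) 1) {r : ℝ}
    (hr : 0 < r) (hr1 : r < 1) (k : ℕ) :
    ((Real.log 2 + Real.log r +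
      2 / k * r ^ k * (∫ x, (Chebyshev.T ℝ k).eval x ∂ν) ^ 2 : ℝ) : EReal) ≤ realEnergy ν := by
  have hi := integrable_abelKernel hν hr.le hr1
  have h1 : extIntegral (ν.prod ν)
      (fun q => ((Real.log 2 + Real.log r + abelKernel r q : ℝ) : EReal)) ≤ realEnergy ν := by
    refine extIntegral_mono_ae ((ae_prod_mem_Icc hν).mono fun q hq => ?_)
    simp only [logKernel_eq]
    split_ifs with hxy
    · exact le_top
    · exact EReal.coe_le_coe_iff.2 (abelKernel_le hr hq.1 hq.2 hxy)
  rw [extIntegral_coe (by exact (integrable_const _).add hi),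
    integral_add (integrable_const _) hi] at h1
  refine le_trans (EReal.coe_le_coe_iff.2 ?_) h1
  have := le_integral_abelKernel hν hr.le hr1 k
  simp only [integral_const, smul_eq_mul, probReal_univ, one_mul]
  linarith

/-- Let `r` tend to 1 from below. The case `k = 0`, where `2 / k` is zero, is the bare bound by `log
2`; the other `k` give uniqueness. -/
theorem log_two_add_le_realEnergy [IsProbabilityMeasure ν]
    (hν : ∀ᵐ x ∂ν, x ∈ Set.Icc (-1 : ℝ) 1) (k : ℕ) :
    ((Real.log 2 + 2 / k * (∫ x, (Chebyshev.T ℝ k).eval x ∂ν) ^ 2 : ℝ) : EReal)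
      ≤ realEnergy ν := by
  set m := (∫ x, (Chebyshev.T ℝ k).eval x ∂ν) ^ 2
  have hc : ContinuousAt (fun r : ℝ => Real.log 2 + Real.log r + 2 / k * r ^ k * m) 1 := by
    have : ContinuousAt Real.log 1 := Real.continuousAt_log one_ne_zero
    fun_prop
  have h2 : Tendsto (fun r : ℝ => ((Real.log 2 + Real.log r + 2 / k * r ^ k * m : ℝ) : EReal))
      (𝓝[<] 1) (𝓝 ((Real.log 2 + 2 / k * m : ℝ) : EReal)) := by
    refine (continuous_coe_real_ereal.tendsto _).comp ?_
    have := hc.tendsto.mono_left (nhdsWithin_le_nhds (s := Set.Iio 1))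
    simpa using this
  refine le_of_tendsto h2 ?_
  have : Set.Ioo (0 : ℝ) 1 ∈ 𝓝[<] (1 : ℝ) := Ioo_mem_nhdsLT one_pos
  filter_upwards [this] with r hr
  exact le_realEnergy hν hr.1 hr.2 k

theorem realEnergy_arcsine : realEnergy arcsine = ((Real.log 2 : ℝ) : EReal) := by
  have hmem : ∀ᵐ x ∂arcsine, x ∈ Set.Icc (-1 : ℝ) 1 :=
    arcsine_ae_mem.mono fun x hx => Set.Ioo_subset_Icc_self hx
  have hmeas : Measurable fun q : ℝ × ℝ => Real.log |q.1 - q.2| := by fun_prop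
  have hle : ∀ {x y : ℝ}, x ∈ Set.Icc (-1 : ℝ) 1 → y ∈ Set.Icc (-1 : ℝ) 1 →
      Real.log |x - y| ≤ Real.log 2 := by
    intro x y hx hy
    rcases eq_or_ne x y with rfl | h
    · simpa using (Real.log_pos one_lt_two).le
    · refine Real.log_le_log (abs_pos.2 (sub_ne_zero.2 h)) (abs_le.2 ⟨?_, ?_⟩) <;>
        linarith [hx.1, hx.2, hy.1, hy.2]
  have hint : Integrable (fun q : ℝ × ℝ => Real.log |q.1 - q.2|) (arcsine.prod arcsine) := by
    refine (integrable_prod_iff' hmeas.aestronglyMeasurable).2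
      ⟨hmem.mono fun y hy => integrable_log_abs_sub_arcsine hy, ?_⟩
    -- Since `u = log |x - y| ≤ log 2`, one has `|u| ≤ 2 log 2 - u`, and the right side integrates
    -- to `3 log 2`.
    refine Integrable.of_bound (C := 3 * Real.log 2)
      (hmeas.norm.stronglyMeasurable.integral_prod_left').aestronglyMeasurable
      (hmem.mono fun y hy => ?_)
    rw [Real.norm_of_nonneg (integral_nonneg fun _ => norm_nonneg _)]
    have hi := integrable_log_abs_sub_arcsine hy
    calc ∫ x, ‖Real.log |x - y|‖ ∂arcsine
        ≤ ∫ x, (2 * Real.log 2 - Real.log |x - y|) ∂arcsine := by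
          refine integral_mono_ae hi.norm ((integrable_const _).sub hi) (hmem.mono fun x hx => ?_)
          have := hle hx hy
          have := Real.log_pos one_lt_two
          simp only [Real.norm_eq_abs]
          exact abs_le.2 ⟨by linarith, by linarith⟩
      _ = 3 * Real.log 2 := by
          rw [integral_sub (integrable_const _) hi, integral_log_abs_sub_arcsine hy]
          simp
          ring
  -- On the diagonal the kernel is `⊤` whereas `Real.log 0 = 0`; the two integrands agree only off
  -- this null set.
  have hdiag : ∀ᵐ q ∂(arcsine.prod arcsine), q.1 ≠ q.2 := by
    have hms : MeasurableSet {q : ℝ × ℝ | q.1 ≠ q.2} :=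
      (measurableSet_eq_fun measurable_fst measurable_snd).compl
    refine (Measure.ae_prod_iff_ae_ae hms).2 (Eventually.of_forall fun x => ?_)
    have : ∀ᵐ y ∂arcsine, y ≠ x := arcsine_absolutelyContinuous.ae_le (Measure.ae_ne volume x)
    exact this.mono fun y hy => hy.symm
  have h1 : realEnergy arcsine
      = extIntegral (arcsine.prod arcsine) (fun q => ((-Real.log |q.1 - q.2| : ℝ) : EReal)) :=
    extIntegral_congr_ae (hdiag.mono fun q hq => by simp only [logKernel_eq, if_neg hq])
  rw [h1, extIntegral_coe (by exact hint.neg), integral_neg, integral_prod_symm _ hint,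
    integral_congr_ae (hmem.mono fun y hy => integral_log_abs_sub_arcsine hy)]
  simp

/-- Any nonzero Chebyshev moment with `k ≥ 1` would push the energy above `log 2`. So all moments
agree with those of the arcsine law; Chebyshev polynomials span all polynomials, and Weierstrass
approximation extends the equality to continuous functions. -/
theorem eq_arcsine_of_realEnergy_le [IsProbabilityMeasure ν]
    (hν : ∀ᵐ x ∂ν, x ∈ Set.Icc (-1 : ℝ) 1) (h : realEnergy ν ≤ ((Real.log 2 : ℝ) : EReal)) :
    ν = arcsine := by
  have hω : ∀ᵐ x ∂arcsine, x ∈ Set.Icc (-1 : ℝ) 1 :=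
    arcsine_ae_mem.mono fun x hx => Set.Ioo_subset_Icc_self hx
  have hT : ∀ k : ℕ, ∫ x, (Chebyshev.T ℝ k).eval x ∂ν = ∫ x, (Chebyshev.T ℝ k).eval x ∂arcsine := by
    intro k
    rcases Nat.eq_zero_or_pos k with rfl | hk
    · simp
    · rw [integral_eval_chebyshev_arcsine (by exact_mod_cast hk.ne')]
      have h1 := EReal.coe_le_coe_iff.1 ((log_two_add_le_realEnergy hν k).trans h)
      have h2 : (0 : ℝ) < 2 / k := by positivity
      by_contra hne
      have : 0 < 2 / (k : ℝ) * (∫ x, (Chebyshev.T ℝ k).eval x ∂ν) ^ 2 := by positivity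
      linarith
  have hpi : ∀ {ρ : Measure ℝ} [IsProbabilityMeasure ρ], (∀ᵐ x ∂ρ, x ∈ Set.Icc (-1 : ℝ) 1) →
      ∀ p : ℝ[X], Integrable (fun x => p.eval x) ρ :=
    fun hρ p => integrable_eval_of_ae_mem_Icc hρ p.continuous
  have hp : ∀ p : ℝ[X], ∫ x, p.eval x ∂ν = ∫ x, p.eval x ∂arcsine := by
    intro p
    have hmem : p ∈ Submodule.span ℝ (Set.range (Chebyshev.chebyshevTsequence ℝ)) := by
      rw [Sequence.span _ fun i => isUnit_iff_ne_zero.2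
        (leadingCoeff_ne_zero.2 (Sequence.ne_zero _ i))]
      trivial
    induction hmem using Submodule.span_induction with
    | mem x hx => obtain ⟨k, rfl⟩ := hx; exact hT k
    | zero => simp
    | add p q _ _ hp hq =>
      simp only [eval_add]
      rw [integral_add (hpi hν _) (hpi hν _), integral_add (hpi hω _) (hpi hω _), hp, hq]
    | smul c p _ hp => simp only [eval_smul, integral_smul, hp]
  refine ext_of_forall_integral_eq_of_IsFiniteMeasure fun f => ?_
  refine eq_of_abs_sub_le_all fun ε hε => ?_
  obtain ⟨p, hpf⟩ := exists_polynomial_near_of_continuousOn (-1) 1 f f.continuous.continuousOn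
    (ε / 2) (by positivity)
  have hclose : ∀ {ρ : Measure ℝ} [IsProbabilityMeasure ρ], (∀ᵐ x ∂ρ, x ∈ Set.Icc (-1 : ℝ) 1) →
      |∫ x, p.eval x ∂ρ - ∫ x, f x ∂ρ| ≤ ε / 2 := by
    intro ρ _ hρ
    rw [← integral_sub (hpi hρ p) (f.integrable ρ)]
    have := norm_integral_le_of_norm_le_const (μ := ρ) (f := fun x => p.eval x - f x)
      (hρ.mono fun x hx => (hpf x hx).le)
    simpa using this
  have a1 := abs_le.1 (hclose hν)
  have a2 := abs_le.1 (hclose hω)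
  rw [hp p] at a1
  exact abs_le.2 ⟨by linarith, by linarith⟩

end Energy

/-! ### Equilibrium measure and capacity of the segment in the plane. -/

section Equilibrium

/-- The interval `[-1, 1]` as a subset of the complex plane. -/
def unitSegment : Set ℂ := (fun x : ℝ => (x : ℂ)) '' Set.Icc (-1) 1

theorem isClosed_unitSegment : IsClosed unitSegment :=
  (isCompact_Icc.image Complex.continuous_ofReal).isClosed

theorem measurableEmbedding_ofReal : MeasurableEmbedding (fun x : ℝ => (x : ℂ)) :=
  Complex.isometry_ofReal.isClosedEmbedding.measurableEmbedding

theorem map_ofReal_compl_unitSegment {ν : Measure ℝ} (h : ∀ᵐ x ∂ν, x ∈ Set.Icc (-1 : ℝ) 1) :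
    ν.map (fun x : ℝ => (x : ℂ)) unitSegmentᶜ = 0 := by
  rw [measurableEmbedding_ofReal.map_apply]
  refine measure_mono_null (fun x hx hmem => hx ⟨x, hmem, rfl⟩) h

theorem exists_map_ofReal_of_mem_probabilityOn {ν : Measure ℂ} (h : ν ∈ probabilityOn unitSegment) :
    ∃ ρ : Measure ℝ, IsProbabilityMeasure ρ ∧ (∀ᵐ x ∂ρ, x ∈ Set.Icc (-1 : ℝ) 1) ∧
      ν = ρ.map (fun x : ℝ => (x : ℂ)) := by
  obtain ⟨h1, h2⟩ := h
  have hae : ∀ᵐ z ∂ν, z ∈ unitSegment := h2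
  refine ⟨ν.map Complex.re, Measure.isProbabilityMeasure_map Complex.measurable_re.aemeasurable,
    ?_, ?_⟩
  · refine (ae_map_iff Complex.measurable_re.aemeasurable measurableSet_Icc).2 ?_
    filter_upwards [hae] with z hz
    obtain ⟨x, hx, rfl⟩ := hz
    simpa using hx
  · rw [Measure.map_map Complex.measurable_ofReal Complex.measurable_re]
    conv_lhs => rw [← Measure.map_id (μ := ν)]
    refine Measure.map_congr ?_
    filter_upwards [hae] with z hz
    obtain ⟨x, hx, rfl⟩ := hz
    simp

/-- The arcsine distribution on `[-1, 1]`, as a measure on the complex plane. -/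
noncomputable def complexArcsine : Measure ℂ := arcsine.map (fun x : ℝ => (x : ℂ))

theorem complexArcsine_mem_probabilityOn : complexArcsine ∈ probabilityOn unitSegment :=
  ⟨Measure.isProbabilityMeasure_map Complex.measurable_ofReal.aemeasurable,
    map_ofReal_compl_unitSegment (arcsine_ae_mem.mono fun _ hx => Set.Ioo_subset_Icc_self hx)⟩

theorem energy_complexArcsine : energy complexArcsine = ((Real.log 2 : ℝ) : EReal) := by
  rw [complexArcsine, energy_map_ofReal, realEnergy_arcsine]

theorem log_two_le_energy {ν : Measure ℂ} (h : ν ∈ probabilityOn unitSegment) :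
    ((Real.log 2 : ℝ) : EReal) ≤ energy ν := by
  obtain ⟨ρ, _, hρ, rfl⟩ := exists_map_ofReal_of_mem_probabilityOn h
  rw [energy_map_ofReal]
  simpa using log_two_add_le_realEnergy hρ 0

/-- Uniqueness is essential here, since `equilibriumMeasure` is an arbitrary choice among
minimisers. -/
theorem isEquilibriumMeasure_iff {ν : Measure ℂ} :
    IsEquilibriumMeasure unitSegment ν ↔ ν = complexArcsine := by
  constructor
  · rintro ⟨h1, h2⟩
    have h3 := h2 _ complexArcsine_mem_probabilityOn
    obtain ⟨ρ, _, hρ, rfl⟩ := exists_map_ofReal_of_mem_probabilityOn h1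
    rw [energy_complexArcsine, energy_map_ofReal] at h3
    rw [eq_arcsine_of_realEnergy_le hρ h3, complexArcsine]
  · rintro rfl
    exact ⟨complexArcsine_mem_probabilityOn, fun ν' h => by
      rw [energy_complexArcsine]; exact log_two_le_energy h⟩

theorem equilibriumMeasure_unitSegment : equilibriumMeasure unitSegment = complexArcsine := by
  have h : ∃ ν, IsEquilibriumMeasure unitSegment ν := ⟨_, isEquilibriumMeasure_iff.2 rfl⟩
  rw [equilibriumMeasure, dif_pos h]
  exact isEquilibriumMeasure_iff.1 h.choose_spec

theorem capacity_unitSegment : capacity unitSegment = 1 / 2 := by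
  have h : ⨅ ν ∈ probabilityOn unitSegment, energy ν = ((Real.log 2 : ℝ) : EReal) := by
    refine le_antisymm ?_ (le_iInf₂ fun ν hν => log_two_le_energy hν)
    exact (iInf₂_le _ complexArcsine_mem_probabilityOn).trans energy_complexArcsine.le
  rw [capacity, h, ← EReal.coe_neg, EReal.exp_coe, ENNReal.toReal_ofReal (Real.exp_pos _).le,
    Real.exp_neg, Real.exp_log two_pos, one_div]

end Equilibrium

/-! ### Monic Jacobi polynomials and their norms. -/

section JacobiPolynomials

theorem integral_rpow_mul_one_sub_rpow {a b : ℝ} (ha : 0 < a) (hb : 0 < b) :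
    ∫ x in (0 : ℝ)..1, x ^ (a - 1) * (1 - x) ^ (b - 1) = ProbabilityTheory.beta a b := by
  have h : Complex.betaIntegral a b
      = ((∫ x in (0 : ℝ)..1, x ^ (a - 1) * (1 - x) ^ (b - 1) : ℝ) : ℂ) := by
    rw [Complex.betaIntegral, ← intervalIntegral.integral_ofReal]
    refine intervalIntegral.integral_congr fun x hx => ?_
    rw [Set.uIcc_of_le zero_le_one] at hx
    rw [Complex.ofReal_mul, Complex.ofReal_cpow hx.1, Complex.ofReal_cpow (sub_nonneg.2 hx.2)]
    push_cast
    rfl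
  rw [ProbabilityTheory.beta_eq_betaIntegralReal a b ha hb, h, Complex.ofReal_re]

theorem integral_jacobiWeight {α β : ℝ} (hα : -1 < α) (hβ : -1 < β) :
    ∫ x in (-1 : ℝ)..1, jacobiWeight α β x
      = 2 ^ (α + β + 1) * ProbabilityTheory.beta (α + 1) (β + 1) := by
  have h1 := intervalIntegral.integral_comp_mul_add (a := 0) (b := 1) (c := -2)
    (jacobiWeight α β) (by norm_num) 1
  have h2 : ∫ x in (0 : ℝ)..1, jacobiWeight α β (-2 * x + 1)
      = ∫ x in (0 : ℝ)..1, 2 ^ (α + β) * (x ^ (α + 1 - 1) * (1 - x) ^ (β + 1 - 1)) := by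
    refine intervalIntegral.integral_congr fun x hx => ?_
    rw [Set.uIcc_of_le zero_le_one] at hx
    simp only [jacobiWeight, add_sub_cancel_right]
    rw [show 1 - (-2 * x + 1) = 2 * x by ring, show 1 + (-2 * x + 1) = 2 * (1 - x) by ring,
      Real.mul_rpow two_pos.le hx.1, Real.mul_rpow two_pos.le (sub_nonneg.2 hx.2),
      Real.rpow_add two_pos]
    ring
  rw [h2, intervalIntegral.integral_const_mul,
    integral_rpow_mul_one_sub_rpow (by linarith) (by linarith)] at h1
  norm_num at h1
  rw [intervalIntegral.integral_symm (-1) 1] at h1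
  rw [Real.rpow_add_one two_ne_zero]
  linarith

theorem integral_jacobiWeight_pos {α β : ℝ} (hα : -1 < α) (hβ : -1 < β) :
    0 < ∫ x in (-1 : ℝ)..1, jacobiWeight α β x := by
  rw [integral_jacobiWeight hα hβ]
  have := ProbabilityTheory.beta_pos (neg_lt_iff_pos_add.1 hα) (neg_lt_iff_pos_add.1 hβ)
  positivity

theorem intervalIntegrable_jacobiWeight {α β : ℝ} (hα : -1 < α) (hβ : -1 < β) :
    IntervalIntegrable (jacobiWeight α β) volume (-1) 1 := by
  -- Again the integral, evaluated without assuming integrability, would be 0 otherwise.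
  by_contra h
  exact (integral_jacobiWeight_pos hα hβ).ne' (intervalIntegral.integral_undef h)

theorem intervalIntegrable_mul_jacobiWeight {α β : ℝ} (hα : -1 < α) (hβ : -1 < β) {f : ℝ → ℝ}
    (hf : Continuous f) : IntervalIntegrable (fun x => f x * jacobiWeight α β x) volume (-1) 1 :=
  (intervalIntegrable_jacobiWeight hα hβ).continuousOn_mul hf.continuousOn

/-- The polynomial `((1 - x) ^ (α + 1) (1 + x) ^ (β + 1) F)' / ((1 - x) ^ α (1 + x) ^ β)`. -/
noncomputable def jacobiDivergence (α β : ℝ) (F : ℝ[X]) : ℝ[X] :=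
  (1 - X ^ 2) * derivative F + (C (β - α) - C (α + β + 2) * X) * F

theorem integral_jacobiDivergence {α β : ℝ} (hα : -1 < α) (hβ : -1 < β) (F : ℝ[X]) :
    ∫ x in (-1 : ℝ)..1, (jacobiDivergence α β F).eval x * jacobiWeight α β x = 0 := by
  have hcont : Continuous fun x : ℝ => F.eval x * jacobiWeight (α + 1) (β + 1) x := by
    unfold jacobiWeight
    have h1 : Continuous fun x : ℝ => (1 - x) ^ (α + 1) :=
      (continuous_const.sub continuous_id).rpow_const fun _ => Or.inr (by linarith)
    have h2 : Continuous fun x : ℝ => (1 + x) ^ (β + 1) :=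
      (continuous_const.add continuous_id).rpow_const fun _ => Or.inr (by linarith)
    exact F.continuous.mul (h1.mul h2)
  rw [intervalIntegral.integral_eq_sub_of_hasDerivAt_of_le (by norm_num) hcont.continuousOn
    (fun x hx => ?_) (intervalIntegrable_mul_jacobiWeight hα hβ (Polynomial.continuous _))]
  · simp only [jacobiWeight]
    rw [sub_self, Real.zero_rpow (by linarith), show (1 : ℝ) + -1 = 0 by norm_num,
      Real.zero_rpow (by linarith)]
    ring
  · have hx1 : 0 < 1 - x := sub_pos.2 hx.2
    have hx2 : 0 < 1 + x := by linarith [hx.1]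
    have d1 : HasDerivAt (fun x : ℝ => (1 - x) ^ (α + 1)) (-1 * (α + 1) * (1 - x) ^ α) x := by
      simpa using ((hasDerivAt_id x).const_sub 1).rpow_const (p := α + 1) (Or.inl hx1.ne')
    have d2 : HasDerivAt (fun x : ℝ => (1 + x) ^ (β + 1)) (1 * (β + 1) * (1 + x) ^ β) x := by
      simpa using ((hasDerivAt_id x).const_add 1).rpow_const (p := β + 1) (Or.inl hx2.ne')
    refine ((F.hasDerivAt x).mul (d1.mul d2)).congr_deriv ?_
    simp only [jacobiWeight, jacobiDivergence, eval_add, eval_mul, eval_sub, eval_one, eval_pow,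
      eval_X, eval_C, Pi.mul_apply]
    rw [Real.rpow_add_one hx1.ne', Real.rpow_add_one hx2.ne']
    ring

/-- Integration by parts: `jacobiDivergence` is minus the adjoint of differentiation, between the
weights with parameters `(α, β)` and `(α + 1, β + 1)`. Boundary terms vanish because `α + 1` and `β
+ 1` are positive. -/
theorem integral_mul_jacobiDivergence {α β : ℝ} (hα : -1 < α) (hβ : -1 < β) (f q : ℝ[X]) :
    ∫ x in (-1 : ℝ)..1, f.eval x * (jacobiDivergence α β q).eval x * jacobiWeight α β x
      = -∫ x in (-1 : ℝ)..1,
          (derivative f).eval x * q.eval x * jacobiWeight (α + 1) (β + 1) x := by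
  have h := integral_jacobiDivergence hα hβ (f * q)
  have e : ∀ x ∈ Set.uIcc (-1 : ℝ) 1,
      (jacobiDivergence α β (f * q)).eval x * jacobiWeight α β x =
      f.eval x * (jacobiDivergence α β q).eval x * jacobiWeight α β x +
      (derivative f).eval x * q.eval x * jacobiWeight (α + 1) (β + 1) x := by
    intro x hx
    rw [Set.uIcc_of_le (by norm_num)] at hx
    have w : jacobiWeight (α + 1) (β + 1) x = (1 - x ^ 2) * jacobiWeight α β x := by
      simp only [jacobiWeight]
      -- The primed form also covers the endpoints, where the base is 0; it needs only that the
      -- raised exponent is nonzero.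
      rw [Real.rpow_add_one' (sub_nonneg.2 hx.2) (by linarith),
        Real.rpow_add_one' (by linarith [hx.1]) (by linarith)]
      ring
    rw [w]
    simp only [jacobiDivergence, eval_add, eval_mul, eval_sub, eval_one, eval_pow, derivative_mul,
      eval_X, eval_C]
    ring
  rw [intervalIntegral.integral_congr e, intervalIntegral.integral_add
    (intervalIntegrable_mul_jacobiWeight hα hβ (by fun_prop))
    (intervalIntegrable_mul_jacobiWeight (by linarith) (by linarith) (by fun_prop))] at h
  linarith

theorem natDegree_jacobiDivergence_le (α β : ℝ) (q : ℝ[X]) :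
    (jacobiDivergence α β q).natDegree ≤ q.natDegree + 1 := by
  unfold jacobiDivergence
  rcases Nat.eq_zero_or_pos q.natDegree with h | h
  · rw [eq_C_of_natDegree_eq_zero h]
    simp only [derivative_C, mul_zero, zero_add, natDegree_C]
    compute_degree
  · have hd := natDegree_derivative_le q
    have h1 : ((1 - X ^ 2) * derivative q : ℝ[X]).natDegree ≤ 2 + (q.natDegree - 1) :=
      natDegree_mul_le_of_le (by compute_degree) hd
    have h2 : ((C (β - α) - C (α + β + 2) * X) * q : ℝ[X]).natDegree ≤ 1 + q.natDegree :=
      natDegree_mul_le_of_le (by compute_degree) le_rfl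
    exact natDegree_add_le_of_degree_le (h1.trans (by omega)) (h2.trans (by omega))

theorem coeff_jacobiDivergence {α β : ℝ} {q : ℝ[X]} {n : ℕ} (hq : q.Monic)
    (hn : q.natDegree = n) :
    (jacobiDivergence α β q).coeff (n + 1) = -(n + α + β + 2) := by
  have hc : q.coeff n = 1 := hn ▸ hq.coeff_natDegree
  have hc1 : q.coeff (n + 1) = 0 := coeff_eq_zero_of_natDegree_lt (by omega)
  have hc2 : q.coeff (n + 2) = 0 := coeff_eq_zero_of_natDegree_lt (by omega)
  have e : jacobiDivergence α β q = derivative q - X ^ 2 * derivative q + C (β - α) * q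
      - C (α + β + 2) * (q * X) := by
    unfold jacobiDivergence; ring
  have hx : (X ^ 2 * derivative q : ℝ[X]).coeff (n + 1) = (n : ℝ) := by
    rcases n with _ | n
    · rw [eq_C_of_natDegree_eq_zero hn]; simp
    · rw [coeff_X_pow_mul, coeff_derivative, hc]
      push_cast; ring
  rw [e, coeff_sub, coeff_add, coeff_sub, hx, coeff_derivative, coeff_C_mul, coeff_C_mul,
    coeff_mul_X, hc, hc1, hc2]
  ring

/-- The squared norm of the monic Jacobi polynomial of degree `n` with respect to the weight
`(1 - x) ^ α (1 + x) ^ β`. -/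
noncomputable def jacobiSqNorm (n : ℕ) (α β : ℝ) : ℝ :=
  n.factorial / (∏ j ∈ Finset.range n, (n + α + β + 1 + j)) *
    (2 ^ (α + β + 2 * n + 1) * ProbabilityTheory.beta (α + n + 1) (β + n + 1))

theorem jacobiSqNorm_succ (n : ℕ) (α β : ℝ) :
    jacobiSqNorm (n + 1) α β
      = (n + 1) / (n + α + β + 2) * jacobiSqNorm n (α + 1) (β + 1) := by
  unfold jacobiSqNorm
  rw [Finset.prod_range_succ', Nat.factorial_succ]
  have h1 : ∏ k ∈ Finset.range n, (((n + 1 : ℕ) : ℝ) + α + β + 1 + ((k + 1 : ℕ) : ℝ))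
      = ∏ k ∈ Finset.range n, ((n : ℝ) + (α + 1) + (β + 1) + 1 + k) :=
    Finset.prod_congr rfl fun k _ => by push_cast; ring
  have h2 : α + β + 2 * ((n + 1 : ℕ) : ℝ) + 1 = α + 1 + (β + 1) + 2 * n + 1 := by push_cast; ring
  have h3 : α + ((n + 1 : ℕ) : ℝ) + 1 = α + 1 + n + 1 := by push_cast; ring
  have h4 : β + ((n + 1 : ℕ) : ℝ) + 1 = β + 1 + n + 1 := by push_cast; ring
  have h5 : ((n + 1 : ℕ) : ℝ) + α + β + 1 + ((0 : ℕ) : ℝ) = n + α + β + 2 := by push_cast; ring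
  rw [h1, h2, h3, h4, h5, mul_comm (∏ k ∈ Finset.range n, _), Nat.cast_mul, mul_div_mul_comm,
    Nat.cast_succ]
  ring

/-- Rodrigues' formula one derivative at a time: the polynomial of degree `n + 1` is the normalised
divergence of the one of degree `n` for raised parameters, and pairing `f` with the former becomes
pairing `f'` with the latter. Allowing all `f` of degree at most `n` records orthogonality and the
norm together, which lets the induction close. -/
theorem exists_monic_jacobi (n : ℕ) : ∀ {α β : ℝ}, -1 < α → -1 < β →
    ∃ p : ℝ[X], p.Monic ∧ p.natDegree = n ∧ ∀ f : ℝ[X], f.natDegree ≤ n →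
      ∫ x in (-1 : ℝ)..1, f.eval x * p.eval x * jacobiWeight α β x
        = f.coeff n * jacobiSqNorm n α β := by
  induction n with
  | zero =>
    intro α β hα hβ
    refine ⟨1, monic_one, natDegree_one, fun f hf => ?_⟩
    rw [eq_C_of_natDegree_eq_zero (Nat.le_zero.1 hf)]
    simp only [eval_C, eval_one, mul_one, coeff_C_zero]
    rw [intervalIntegral.integral_const_mul, integral_jacobiWeight hα hβ]
    simp [jacobiSqNorm]
  | succ n ih =>
    intro α β hα hβ
    obtain ⟨q, hq, hqn, hqi⟩ := ih (α := α + 1) (β := β + 1) (by linarith) (by linarith)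
    have hpos : (0 : ℝ) < n + α + β + 2 := by
      have : (0 : ℝ) ≤ n := n.cast_nonneg
      linarith
    have hdeg : (C (-(n + α + β + 2)⁻¹) * jacobiDivergence α β q).natDegree ≤ n + 1 :=
      (natDegree_C_mul_le _ _).trans (hqn ▸ natDegree_jacobiDivergence_le α β q)
    have hcoeff : (C (-(n + α + β + 2)⁻¹) * jacobiDivergence α β q).coeff (n + 1) = 1 := by
      rw [coeff_C_mul, coeff_jacobiDivergence hq hqn]
      field_simp
    refine ⟨C (-(n + α + β + 2)⁻¹) * jacobiDivergence α β q,
      monic_of_natDegree_le_of_coeff_eq_one _ hdeg hcoeff, ?_, fun f hf => ?_⟩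
    · exact natDegree_eq_of_le_of_coeff_ne_zero hdeg (by rw [hcoeff]; exact one_ne_zero)
    · have hf' : (derivative f).natDegree ≤ n := (natDegree_derivative_le f).trans (by omega)
      have e : ∀ x : ℝ, f.eval x * (C (-(n + α + β + 2)⁻¹) * jacobiDivergence α β q).eval x *
          jacobiWeight α β x = -(n + α + β + 2)⁻¹ *
            (f.eval x * (jacobiDivergence α β q).eval x * jacobiWeight α β x) := fun x => by
        rw [eval_mul, eval_C]; ring
      simp only [e]
      rw [intervalIntegral.integral_const_mul, integral_mul_jacobiDivergence hα hβ, hqi _ hf',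
        coeff_derivative, jacobiSqNorm_succ]
      field_simp

/-- The squared norm of the monic Jacobi polynomial is minimal. -/
theorem jacobiSqNorm_le_integral {α β : ℝ} (hα : -1 < α) (hβ : -1 < β) {n : ℕ} {f : ℝ[X]}
    (hf : f.Monic) (hn : f.natDegree = n) :
    jacobiSqNorm n α β ≤ ∫ x in (-1 : ℝ)..1, f.eval x ^ 2 * jacobiWeight α β x := by
  obtain ⟨p, hp, hpn, hpi⟩ := exists_monic_jacobi n hα hβ
  have h1 := hpi f hn.le
  have h2 := hpi p hpn.le
  rw [show f.coeff n = 1 from hn ▸ hf.coeff_natDegree, one_mul] at h1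
  rw [show p.coeff n = 1 from hpn ▸ hp.coeff_natDegree, one_mul] at h2
  -- As `f` and `p` are both monic, their inner product equals the squared norm of `p`, so expanding
  -- the square leaves the difference of the two squared norms.
  have h3 : 0 ≤ ∫ x in (-1 : ℝ)..1, (f.eval x - p.eval x) ^ 2 * jacobiWeight α β x := by
    refine intervalIntegral.integral_nonneg (by norm_num) fun x hx => ?_
    have := Real.rpow_nonneg (sub_nonneg.2 hx.2) α
    have := Real.rpow_nonneg (show 0 ≤ 1 + x by linarith [hx.1]) β
    unfold jacobiWeight
    positivity
  have e : ∀ x : ℝ, (f.eval x - p.eval x) ^ 2 * jacobiWeight α β x =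
      f.eval x ^ 2 * jacobiWeight α β x - 2 * (f.eval x * p.eval x * jacobiWeight α β x) +
      p.eval x * p.eval x * jacobiWeight α β x := fun x => by ring
  simp only [e] at h3
  have i1 := intervalIntegrable_mul_jacobiWeight hα hβ
    (f := fun x => f.eval x ^ 2) (by fun_prop)
  have i2 := intervalIntegrable_mul_jacobiWeight hα hβ
    (f := fun x => f.eval x * p.eval x) (by fun_prop)
  have i3 := intervalIntegrable_mul_jacobiWeight hα hβ
    (f := fun x => p.eval x * p.eval x) (by fun_prop)
  rw [intervalIntegral.integral_add (i1.sub (i2.const_mul 2)) i3,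
    intervalIntegral.integral_sub i1 (i2.const_mul 2), intervalIntegral.integral_const_mul,
    h1, h2] at h3
  linarith

theorem exists_integral_eq_jacobiSqNorm {α β : ℝ} (hα : -1 < α) (hβ : -1 < β) (n : ℕ) :
    ∃ p : ℝ[X], p.Monic ∧ p.natDegree = n ∧
      ∫ x in (-1 : ℝ)..1, p.eval x ^ 2 * jacobiWeight α β x = jacobiSqNorm n α β := by
  obtain ⟨p, hp, hpn, hpi⟩ := exists_monic_jacobi n hα hβ
  refine ⟨p, hp, hpn, ?_⟩
  have h2 := hpi p hpn.le
  rw [show p.coeff n = 1 from hpn ▸ hp.coeff_natDegree, one_mul] at h2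
  simpa only [sq] using h2

end JacobiPolynomials

/-! ### The Gamma quotient: recursion, limit and infimum. -/

section WidomRatio

theorem prod_range_add_mul_Gamma {z : ℝ} (hz : 0 < z) (n : ℕ) :
    (∏ j ∈ Finset.range n, (z + j)) * Real.Gamma z = Real.Gamma (z + n) := by
  induction n with
  | zero => simp
  | succ n ih =>
    rw [Finset.prod_range_succ, mul_right_comm, ih, Nat.cast_succ, ← add_assoc,
      Real.Gamma_add_one (by positivity), mul_comm]

/-- Euler's limit for `Γ(a)`, with the product `a (a + 1) ⋯ (a + m)` rewritten as `Γ(m + a + 1) /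
Γ(a)`; the factor `1 + a / m` lowers the argument by one. -/
theorem tendsto_Gamma_natCast_add_div {a : ℝ} (ha : 0 < a) :
    Tendsto (fun m : ℕ => Real.Gamma (m + a) / (m.factorial * (m : ℝ) ^ (a - 1)))
      atTop (𝓝 1) := by
  have h1 := Real.GammaSeq_tendsto_Gamma a
  have hG : Real.Gamma a ≠ 0 := (Real.Gamma_pos_of_pos ha).ne'
  have h2 : Tendsto (fun m : ℕ => 1 + a * (m : ℝ)⁻¹) atTop (𝓝 (1 + a * 0)) :=
    (tendsto_inv_atTop_nhds_zero_nat.const_mul a).const_add 1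
  have h3 := (h1.const_mul (Real.Gamma a)⁻¹).inv₀ (by simp [hG])
  have h4 := h3.mul (h2.inv₀ (by simp))
  rw [inv_mul_cancel₀ hG, mul_zero, add_zero, inv_one, mul_one] at h4
  refine h4.congr' ?_
  filter_upwards [eventually_ge_atTop 1] with m hm
  have hm0 : (0 : ℝ) < m := by exact_mod_cast hm
  have hp := prod_range_add_mul_Gamma ha (m + 1)
  rw [Nat.cast_succ, ← add_assoc, Real.Gamma_add_one (by positivity), add_comm a] at hp
  have hne : ∏ j ∈ Finset.range (m + 1), (a + (j : ℝ)) ≠ 0 :=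
    (Finset.prod_pos fun j _ => by positivity).ne'
  have hf : (m.factorial : ℝ) ≠ 0 := by positivity
  rw [Real.GammaSeq, Real.rpow_sub_one hm0.ne']
  have hp2 : Real.Gamma (m + a)
      = (∏ j ∈ Finset.range (m + 1), (a + (j : ℝ))) * Real.Gamma a / (m + a) := by
    rw [hp]; field_simp
  have : (m : ℝ) ^ a ≠ 0 := (Real.rpow_pos_of_pos hm0 a).ne'
  have : (m : ℝ) + a ≠ 0 := by positivity
  rw [hp2]
  field_simp

/-- The quotient of the squared Widom factor and the entropy of the Jacobi weight. -/
noncomputable def widomRatio (α β : ℝ) (n : ℕ) : ℝ :=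
  2 ^ (4 * n + 2 * (α + β) + 2) *
    (Real.Gamma (n + 1) * Real.Gamma (n + α + 1) * Real.Gamma (n + β + 1) *
      Real.Gamma (n + (α + β) + 1)) /
    (Real.pi * (Real.Gamma (2 * n + (α + β) + 1) * Real.Gamma (2 * n + (α + β) + 2)))

variable {α β : ℝ}

theorem widomRatio_pos (hα : -1 < α) (hβ : -1 < β) {n : ℕ} (hn : 1 ≤ n) :
    0 < widomRatio α β n := by
  have h : (1 : ℝ) ≤ n := by exact_mod_cast hn
  have := Real.pi_pos
  have := Real.Gamma_pos_of_pos (show (0 : ℝ) < n + 1 by linarith)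
  have := Real.Gamma_pos_of_pos (show (0 : ℝ) < n + α + 1 by linarith)
  have := Real.Gamma_pos_of_pos (show (0 : ℝ) < n + β + 1 by linarith)
  have := Real.Gamma_pos_of_pos (show (0 : ℝ) < n + (α + β) + 1 by linarith)
  have := Real.Gamma_pos_of_pos (show (0 : ℝ) < 2 * n + (α + β) + 1 by linarith)
  have := Real.Gamma_pos_of_pos (show (0 : ℝ) < 2 * n + (α + β) + 2 by linarith)
  unfold widomRatio
  positivity

/-- The factor `4 ^ n` comes from capacity `1/2`, and `π / 2 ^ (α + β + 1)` is the entropy without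
the normalization. For `n ≥ 1` the number `n + α + β + 1` is positive, so the product in the norm is
a quotient of Gamma values. -/
theorem four_pow_mul_jacobiSqNorm (hα : -1 < α) (hβ : -1 < β) {n : ℕ} (hn : 1 ≤ n) :
    4 ^ n * jacobiSqNorm n α β = widomRatio α β n * (Real.pi / 2 ^ (α + β + 1)) := by
  have h : (1 : ℝ) ≤ n := by exact_mod_cast hn
  have hz : (0 : ℝ) < n + α + β + 1 := by linarith
  have hp := prod_range_add_mul_Gamma hz n
  have hG := Real.Gamma_pos_of_pos hz
  have hG' := Real.Gamma_pos_of_pos (show (0 : ℝ) < n + α + β + 1 + n by linarith)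
  have hP : ∏ j ∈ Finset.range n, ((n : ℝ) + α + β + 1 + j) ≠ 0 := by
    intro h0
    rw [h0, zero_mul] at hp
    exact hG'.ne hp
  have hpw : (2 : ℝ) ^ (4 * n + 2 * (α + β) + 2)
      = 4 ^ n * 2 ^ (α + β + 2 * n + 1) * 2 ^ (α + β + 1) := by
    rw [show (4 : ℝ) = 2 ^ (2 : ℝ) by norm_num, ← Real.rpow_natCast (2 ^ (2 : ℝ)),
      ← Real.rpow_mul two_pos.le, ← Real.rpow_add two_pos, ← Real.rpow_add two_pos]
    norm_num
    congr 1
    ring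
  have h2 : (0 : ℝ) < 2 ^ (α + β + 1) := by positivity
  unfold jacobiSqNorm widomRatio ProbabilityTheory.beta
  rw [hpw, Real.Gamma_nat_eq_factorial,
    show α + n + 1 + (β + n + 1) = 2 * (n : ℝ) + (α + β) + 2 by ring,
    show 2 * (n : ℝ) + (α + β) + 1 = n + α + β + 1 + n by ring, ← hp,
    show (n : ℝ) + (α + β) + 1 = n + α + β + 1 by ring,
    show α + n + 1 = (n : ℝ) + α + 1 by ring, show β + n + 1 = (n : ℝ) + β + 1 by ring]
  have := (Real.Gamma_pos_of_pos (show (0 : ℝ) < 2 * n + (α + β) + 2 by linarith)).ne'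
  have := Real.pi_ne_zero
  field_simp

/-- With `t = 2n + α + β + 2`, the new numerator factors, doubled, are `t ± (α + β)` and `t ± (α -
β)`, which uses up the 16 from the power of 2; the new denominator factors are `t - 1`, `t`, `t`, `t
+ 1`. -/
theorem widomRatio_succ (hα : -1 < α) (hβ : -1 < β) {n : ℕ} (hn : 1 ≤ n) :
    widomRatio α β (n + 1) * (((2 * n + (α + β) + 2) ^ 2 - 1) * (2 * n + (α + β) + 2) ^ 2) =
      widomRatio α β n * (((2 * n + (α + β) + 2) ^ 2 - (α + β) ^ 2) *
        ((2 * n + (α + β) + 2) ^ 2 - (α - β) ^ 2)) := by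
  have h : (1 : ℝ) ≤ n := by exact_mod_cast hn
  have e1 : Real.Gamma ((n + 1 : ℕ) + 1) = (n + 1) * Real.Gamma (n + 1) := by
    rw [Nat.cast_succ, Real.Gamma_add_one (by linarith)]
  have e2 : Real.Gamma ((n + 1 : ℕ) + α + 1) = (n + α + 1) * Real.Gamma (n + α + 1) := by
    rw [Nat.cast_succ, show (n : ℝ) + 1 + α + 1 = n + α + 1 + 1 by ring,
      Real.Gamma_add_one (by linarith)]
  have e3 : Real.Gamma ((n + 1 : ℕ) + β + 1) = (n + β + 1) * Real.Gamma (n + β + 1) := by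
    rw [Nat.cast_succ, show (n : ℝ) + 1 + β + 1 = n + β + 1 + 1 by ring,
      Real.Gamma_add_one (by linarith)]
  have e4 : Real.Gamma ((n + 1 : ℕ) + (α + β) + 1)
      = (n + (α + β) + 1) * Real.Gamma (n + (α + β) + 1) := by
    rw [Nat.cast_succ, show (n : ℝ) + 1 + (α + β) + 1 = n + (α + β) + 1 + 1 by ring,
      Real.Gamma_add_one (by linarith)]
  have e5 : Real.Gamma (2 * n + (α + β) + 2)
      = (2 * n + (α + β) + 1) * Real.Gamma (2 * n + (α + β) + 1) := by
    rw [show 2 * (n : ℝ) + (α + β) + 2 = 2 * n + (α + β) + 1 + 1 by ring,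
      Real.Gamma_add_one (by linarith)]
  have e6 : Real.Gamma (2 * (n + 1 : ℕ) + (α + β) + 1)
      = (2 * n + (α + β) + 2) * Real.Gamma (2 * n + (α + β) + 2) := by
    rw [Nat.cast_succ, show 2 * ((n : ℝ) + 1) + (α + β) + 1 = 2 * n + (α + β) + 2 + 1 by ring,
      Real.Gamma_add_one (by linarith)]
  have e7 : Real.Gamma (2 * (n + 1 : ℕ) + (α + β) + 2)
      = (2 * n + (α + β) + 3) * ((2 * n + (α + β) + 2) * Real.Gamma (2 * n + (α + β) + 2)) := by
    rw [show 2 * ((n + 1 : ℕ) : ℝ) + (α + β) + 2 = 2 * n + (α + β) + 3 + 1 by push_cast; ring,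
      Real.Gamma_add_one (by linarith),
      show 2 * (n : ℝ) + (α + β) + 3 = 2 * n + (α + β) + 2 + 1 by ring,
      Real.Gamma_add_one (by linarith)]
  have e8 : (2 : ℝ) ^ (4 * ((n + 1 : ℕ) : ℝ) + 2 * (α + β) + 2)
      = 16 * 2 ^ (4 * n + 2 * (α + β) + 2) := by
    rw [Nat.cast_succ, show 4 * ((n : ℝ) + 1) + 2 * (α + β) + 2
      = 4 * n + 2 * (α + β) + 2 + (4 : ℕ) by push_cast; ring, Real.rpow_add_natCast two_ne_zero]
    ring
  unfold widomRatio
  rw [e1, e2, e3, e4, e6, e7, e8, e5]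
  have hG := (Real.Gamma_pos_of_pos (show (0 : ℝ) < 2 * n + (α + β) + 1 by linarith)).ne'
  have := Real.pi_ne_zero
  generalize Real.Gamma (2 * n + (α + β) + 1) = G at hG ⊢
  generalize Real.Gamma (n + 1) = G₁
  generalize Real.Gamma (n + α + 1) = G₂
  generalize Real.Gamma (n + β + 1) = G₃
  generalize Real.Gamma (n + (α + β) + 1) = G₄
  generalize (2 : ℝ) ^ (4 * n + 2 * (α + β) + 2) = T
  have a1 : 2 * (n : ℝ) + (α + β) + 1 ≠ 0 := by linarith
  have a2 : 2 * (n : ℝ) + (α + β) + 2 ≠ 0 := by linarith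
  have a3 : 2 * (n : ℝ) + (α + β) + 3 ≠ 0 := by linarith
  rw [div_mul_eq_mul_div, div_mul_eq_mul_div, div_eq_div_iff (by simp [*]) (by simp [*])]
  ring

/-- At index `m + 1`, each Gamma value is compared with a factorial times a power. The factorials
that remain form the Wallis product, up to the factor `2m + 1`, which `2 + 1/m` supplies; the powers
of `m` cancel. -/
theorem tendsto_widomRatio (hα : -1 < α) (hβ : -1 < β) :
    Tendsto (widomRatio α β) atTop (𝓝 2) := by
  rw [← tendsto_add_atTop_iff_nat 1]
  have h2 : Tendsto (fun m : ℕ => 2 * m) atTop atTop :=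
    tendsto_id.const_mul_atTop' two_pos
  have t1 := tendsto_Gamma_natCast_add_div (a := 2) two_pos
  have t2 := tendsto_Gamma_natCast_add_div (a := α + 2) (by linarith)
  have t3 := tendsto_Gamma_natCast_add_div (a := β + 2) (by linarith)
  have t4 := tendsto_Gamma_natCast_add_div (a := α + β + 2) (by linarith)
  have t5 := (tendsto_Gamma_natCast_add_div (a := α + β + 3) (by linarith)).comp h2
  have t6 := (tendsto_Gamma_natCast_add_div (a := α + β + 4) (by linarith)).comp h2
  have t7 := Real.Wallis.tendsto_W_nhds_pi_div_two
  have t8 : Tendsto (fun m : ℕ => 2 + (m : ℝ)⁻¹) atTop (𝓝 (2 + 0)) :=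
    tendsto_inv_atTop_nhds_zero_nat.const_add 2
  have t := ((((t1.mul t2).mul t3).mul t4).div (t5.mul t6) (by norm_num)).mul
    ((t7.mul t8).mul_const (2 / Real.pi))
  have hlim : 1 * 1 * 1 * 1 / (1 * 1) * (Real.pi / 2 * (2 + 0) * (2 / Real.pi)) = 2 := by
    have := Real.pi_ne_zero
    field_simp
    norm_num
  rw [hlim] at t
  refine t.congr' ?_
  filter_upwards [eventually_ge_atTop 1] with m hm
  have hm0 : (0 : ℝ) < m := by exact_mod_cast hm
  have hc : ((2 * m : ℕ) : ℝ) = 2 * m := by push_cast; ring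
  have hpw : (2 : ℝ) ^ (4 * ((m + 1 : ℕ) : ℝ) + 2 * (α + β) + 2)
      = 2 ^ (4 * m) * 2 ^ (α + β + 3 - 1) * 2 ^ (α + β + 4 - 1) * 2 := by
    rw [← Real.rpow_natCast, ← Real.rpow_add two_pos, ← Real.rpow_add two_pos,
      ← Real.rpow_add_one two_ne_zero]
    congr 1
    push_cast
    ring
  have hmp : (m : ℝ) ^ (α + β + 3 - 1) * (m : ℝ) ^ (α + β + 4 - 1) * (m : ℝ)⁻¹
      = (m : ℝ) ^ ((2 : ℝ) - 1) * (m : ℝ) ^ (α + 2 - 1) * (m : ℝ) ^ (β + 2 - 1) *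
        (m : ℝ) ^ (α + β + 2 - 1) := by
    rw [← Real.rpow_neg_one, ← Real.rpow_add hm0, ← Real.rpow_add hm0, ← Real.rpow_add hm0,
      ← Real.rpow_add hm0, ← Real.rpow_add hm0]
    congr 1
    ring
  simp only [Pi.div_apply, Function.comp_apply]
  rw [hc, Real.mul_rpow two_pos.le hm0.le, Real.mul_rpow two_pos.le hm0.le,
    Real.Wallis.W_eq_factorial_ratio]
  unfold widomRatio
  rw [hpw]
  push_cast
  rw [show (m : ℝ) + 1 + 1 = m + 2 by ring, show (m : ℝ) + 1 + α + 1 = m + (α + 2) by ring,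
    show (m : ℝ) + 1 + β + 1 = m + (β + 2) by ring,
    show (m : ℝ) + 1 + (α + β) + 1 = m + (α + β + 2) by ring,
    show 2 * ((m : ℝ) + 1) + (α + β) + 1 = 2 * m + (α + β + 3) by ring,
    show 2 * ((m : ℝ) + 1) + (α + β) + 2 = 2 * m + (α + β + 4) by ring]
  have p1 := Real.rpow_pos_of_pos hm0 ((2 : ℝ) - 1)
  have p2 := Real.rpow_pos_of_pos hm0 (α + 2 - 1)
  have p3 := Real.rpow_pos_of_pos hm0 (β + 2 - 1)
  have p4 := Real.rpow_pos_of_pos hm0 (α + β + 2 - 1)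
  have p5 := Real.rpow_pos_of_pos hm0 (α + β + 3 - 1)
  have p6 := Real.rpow_pos_of_pos hm0 (α + β + 4 - 1)
  have q5 := Real.rpow_pos_of_pos two_pos (α + β + 3 - 1)
  have q6 := Real.rpow_pos_of_pos two_pos (α + β + 4 - 1)
  have hf : (0 : ℝ) < m.factorial := by positivity
  have hf2 : (0 : ℝ) < (2 * m).factorial := by positivity
  have g5 := Real.Gamma_pos_of_pos (show (0 : ℝ) < 2 * m + (α + β + 3) by linarith)
  have g6 := Real.Gamma_pos_of_pos (show (0 : ℝ) < 2 * m + (α + β + 4) by linarith)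
  have hpi := Real.pi_pos
  clear t t1 t2 t3 t4 t5 t6 t7 t8 hpw
  generalize Real.Gamma (m + 2) = G₁
  generalize Real.Gamma (m + (α + 2)) = G₂
  generalize Real.Gamma (m + (β + 2)) = G₃
  generalize Real.Gamma (m + (α + β + 2)) = G₄
  generalize Real.Gamma (2 * m + (α + β + 3)) = G₅ at *
  generalize Real.Gamma (2 * m + (α + β + 4)) = G₆ at *
  generalize (m : ℝ) ^ ((2 : ℝ) - 1) = P1 at *
  generalize (m : ℝ) ^ (α + 2 - 1) = P2 at *
  generalize (m : ℝ) ^ (β + 2 - 1) = P3 at *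
  generalize (m : ℝ) ^ (α + β + 2 - 1) = P4 at *
  generalize (m : ℝ) ^ (α + β + 3 - 1) = P5 at *
  generalize (m : ℝ) ^ (α + β + 4 - 1) = P6 at *
  have hmp' : P5 * P6 = P1 * P2 * P3 * P4 * m := by
    rw [← hmp]; field_simp
  have : 2 * (m : ℝ) + 1 ≠ 0 := by positivity
  field_simp
  linear_combination (G₁ * G₂ * G₃ * G₄) * hmp'

theorem jacobiL_eq_min (hα : -1 < α) (hβ : -1 < β) : jacobiL α β = min 2 (widomRatio α β 1) := by
  unfold jacobiL widomRatio
  congr 1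
  rw [show 2 * ((1 : ℕ) : ℝ) + (α + β) + 2 = α + β + 3 + 1 by push_cast; ring,
    Real.Gamma_add_one (s := α + β + 3) (by linarith)]
  push_cast
  rw [show (4 : ℝ) * 1 + 2 * (α + β) + 2 = 2 * α + 2 * β + 6 by ring,
    show (1 : ℝ) + α + 1 = α + 2 by ring, show (1 : ℝ) + β + 1 = β + 2 by ring,
    show (1 : ℝ) + (α + β) + 1 = α + β + 2 by ring,
    show (2 : ℝ) * 1 + (α + β) + 1 = α + β + 3 by ring, show (1 : ℝ) + 1 = 2 by norm_num,
    Real.Gamma_two]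
  have := (Real.Gamma_pos_of_pos (show (0 : ℝ) < α + β + 3 by linarith)).ne'
  have := Real.pi_ne_zero
  have : α + β + 3 ≠ 0 := by linarith
  field_simp

/-- The polynomial whose sign decides whether `widomRatio` increases from `n` to `n + 1`. -/
noncomputable def ratioDefect (α β : ℝ) (n : ℕ) : ℝ :=
  (α + β) ^ 2 * (α - β) ^ 2 -
    ((α + β) ^ 2 + (α - β) ^ 2 - 1) * (2 * n + (α + β) + 2) ^ 2

theorem widomRatio_succ_sub (hα : -1 < α) (hβ : -1 < β) {n : ℕ} (hn : 1 ≤ n) :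
    (widomRatio α β (n + 1) - widomRatio α β n) *
      (((2 * n + (α + β) + 2) ^ 2 - 1) * (2 * n + (α + β) + 2) ^ 2) =
      widomRatio α β n * ratioDefect α β n := by
  rw [sub_mul, widomRatio_succ hα hβ hn, ratioDefect]
  ring

theorem ratio_denominator_pos (hα : -1 < α) (hβ : -1 < β) {n : ℕ} (hn : 1 ≤ n) :
    0 < ((2 * (n : ℝ) + (α + β) + 2) ^ 2 - 1) * (2 * n + (α + β) + 2) ^ 2 := by
  have h : (1 : ℝ) ≤ n := by exact_mod_cast hn
  have : 2 < 2 * (n : ℝ) + (α + β) + 2 := by linarith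
  exact mul_pos (by nlinarith) (by positivity)

theorem widomRatio_le_succ (hα : -1 < α) (hβ : -1 < β) {n : ℕ} (hn : 1 ≤ n)
    (h : 0 ≤ ratioDefect α β n) : widomRatio α β n ≤ widomRatio α β (n + 1) := by
  refine sub_nonneg.1 (nonneg_of_mul_nonneg_left ?_ (ratio_denominator_pos hα hβ hn))
  rw [widomRatio_succ_sub hα hβ hn]
  exact mul_nonneg (widomRatio_pos hα hβ hn).le h

theorem widomRatio_lt_succ (hα : -1 < α) (hβ : -1 < β) {n : ℕ} (hn : 1 ≤ n)
    (h : 0 < ratioDefect α β n) : widomRatio α β n < widomRatio α β (n + 1) := by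
  refine sub_pos.1 (pos_of_mul_pos_left ?_ (ratio_denominator_pos hα hβ hn).le)
  rw [widomRatio_succ_sub hα hβ hn]
  exact mul_pos (widomRatio_pos hα hβ hn) h

theorem widomRatio_succ_le (hα : -1 < α) (hβ : -1 < β) {n : ℕ} (hn : 1 ≤ n)
    (h : ratioDefect α β n ≤ 0) : widomRatio α β (n + 1) ≤ widomRatio α β n := by
  refine sub_nonpos.1 (nonpos_of_mul_nonpos_left ?_ (ratio_denominator_pos hα hβ hn))
  rw [widomRatio_succ_sub hα hβ hn]
  exact mul_nonpos_of_nonneg_of_nonpos (widomRatio_pos hα hβ hn).le h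

/-- Nonpositivity forces the coefficient `s² + d² - 1` of `t²` to be nonnegative, and then the
defect can only decrease as `t > 0` grows. -/
theorem ratioDefect_nonpos_of_le (hα : -1 < α) (hβ : -1 < β) {m n : ℕ} (hmn : m ≤ n)
    (h : ratioDefect α β m ≤ 0) : ratioDefect α β n ≤ 0 := by
  have h1 : (m : ℝ) ≤ n := by exact_mod_cast hmn
  have h0 : (0 : ℝ) ≤ m := m.cast_nonneg
  have ht : 0 < 2 * (m : ℝ) + (α + β) + 2 := by linarith
  have hsq : (2 * (m : ℝ) + (α + β) + 2) ^ 2 ≤ (2 * n + (α + β) + 2) ^ 2 := by gcongr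
  unfold ratioDefect at h ⊢
  have hu : 0 ≤ (α + β) ^ 2 + (α - β) ^ 2 - 1 := by
    by_contra hneg
    have : 0 ≤ (α + β) ^ 2 * (α - β) ^ 2 := by positivity
    nlinarith [mul_pos (neg_pos.2 (not_le.1 hneg)) (pow_pos ht 2)]
  nlinarith [mul_le_mul_of_nonneg_left hsq hu]

theorem two_le_widomRatio (hα : -1 < α) (hβ : -1 < β) {n : ℕ} (hn : 1 ≤ n)
    (h : ratioDefect α β n ≤ 0) : 2 ≤ widomRatio α β n := by
  have hanti : Antitone fun k => widomRatio α β (n + k) := antitone_nat_of_succ_le fun k =>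
    widomRatio_succ_le hα hβ (n := n + k) (by omega)
      (ratioDefect_nonpos_of_le hα hβ (n := n + k) (by omega) h)
  have ht : Tendsto (fun k => widomRatio α β (n + k)) atTop (𝓝 2) := by
    simpa only [add_comm n] using (tendsto_add_atTop_iff_nat n).2 (tendsto_widomRatio hα hβ)
  exact hanti.le_of_tendsto ht 0

/-- If the defect at `n` is nonpositive, the ratio decreases from there to its limit 2; if positive,
all earlier defects are positive and the ratio has increased since index 1. -/
theorem jacobiL_le_widomRatio (hα : -1 < α) (hβ : -1 < β) {n : ℕ} (hn : 1 ≤ n) :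
    jacobiL α β ≤ widomRatio α β n := by
  rw [jacobiL_eq_min hα hβ]
  rcases le_or_gt (ratioDefect α β n) 0 with h | h
  · exact (min_le_left _ _).trans (two_le_widomRatio hα hβ hn h)
  · refine (min_le_right _ _).trans ?_
    have hmono : ∀ k, k ≤ n → 1 ≤ k → widomRatio α β 1 ≤ widomRatio α β k := by
      intro k hk h1
      induction k, h1 using Nat.le_induction with
      | base => exact le_rfl
      | succ k h1 ih =>
        refine (ih (by omega)).trans (widomRatio_le_succ hα hβ h1 ?_)
        by_contra hneg
        exact absurd (ratioDefect_nonpos_of_le hα hβ (by omega) (not_le.1 hneg).le) (not_le.2 h)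
    exact hmono n le_rfl hn

theorem le_jacobiL (hα : -1 < α) (hβ : -1 < β) {C : ℝ} (h : ∀ n, 1 ≤ n → C ≤ widomRatio α β n) :
    C ≤ jacobiL α β := by
  rw [jacobiL_eq_min hα hβ]
  refine le_min (ge_of_tendsto (tendsto_widomRatio hα hβ) ?_) (h 1 le_rfl)
  filter_upwards [eventually_ge_atTop 1] with n hn using h n hn

theorem max_abs_add_abs_sub (a b : ℝ) : max |a + b| |a - b| = |a| + |b| := by
  rcases abs_cases a with ⟨h1, _⟩ | ⟨h1, _⟩ <;> rcases abs_cases b with ⟨h2, _⟩ | ⟨h2, _⟩ <;>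
  rcases abs_cases (a + b) with ⟨h3, _⟩ | ⟨h3, _⟩ <;>
  rcases abs_cases (a - b) with ⟨h4, _⟩ | ⟨h4, _⟩ <;>
  rcases max_cases |a + b| |a - b| with ⟨h5, _⟩ | ⟨h5, _⟩ <;> linarith

/-- The hypotheses say `s² + d² ≤ 1` and `s², d² < 1`. They make every defect positive: on the
boundary `s² + d² = 1` both squares are nonzero, so `s²d²` is still positive. -/
theorem jacobiL_lt_two (hα : -1 < α) (hβ : -1 < β) (h1 : α ^ 2 + β ^ 2 ≤ 1 / 2)
    (h2 : |α| + |β| < 1) : jacobiL α β < 2 := by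
  rw [← max_abs_add_abs_sub, max_lt_iff] at h2
  have hs : (α + β) ^ 2 < 1 := (sq_lt_one_iff_abs_lt_one _).2 h2.1
  have hd : (α - β) ^ 2 < 1 := (sq_lt_one_iff_abs_lt_one _).2 h2.2
  have hpos : ∀ n : ℕ, 0 < ratioDefect α β n := by
    intro n
    have h0 : (0 : ℝ) ≤ n := n.cast_nonneg
    have ht : 0 < (2 * (n : ℝ) + (α + β) + 2) ^ 2 := pow_pos (by linarith) 2
    have hu : (α + β) ^ 2 + (α - β) ^ 2 - 1 ≤ 0 := by nlinarith
    unfold ratioDefect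
    rcases hu.lt_or_eq with hu | hu
    · have : 0 ≤ (α + β) ^ 2 * (α - β) ^ 2 := by positivity
      nlinarith [mul_pos (neg_pos.2 hu) ht]
    · rw [hu]
      have : 0 < (α + β) ^ 2 * (α - β) ^ 2 := mul_pos (by linarith) (by linarith)
      linarith
  have hmono : Monotone fun k => widomRatio α β (2 + k) := monotone_nat_of_le_succ fun k =>
    widomRatio_le_succ hα hβ (n := 2 + k) (by omega) (hpos _).le
  have ht : Tendsto (fun k => widomRatio α β (2 + k)) atTop (𝓝 2) := by
    simpa only [add_comm 2] using (tendsto_add_atTop_iff_nat 2).2 (tendsto_widomRatio hα hβ)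
  rw [jacobiL_eq_min hα hβ]
  exact (min_le_right _ _).trans_lt
    ((widomRatio_lt_succ hα hβ le_rfl (hpos 1)).trans_le (hmono.ge_of_tendsto ht 0))

theorem jacobiL_eq_two (hα : -1 < α) (hβ : -1 < β)
    (h : 1 ≤ |α| + |β| ∨ 4 - 2 * Real.sqrt 3 < α ^ 2 + β ^ 2) : jacobiL α β = 2 := by
  rw [jacobiL_eq_min hα hβ]
  refine min_eq_left (two_le_widomRatio hα hβ le_rfl ?_)
  set s := α + β with hs
  set d := α - β with hd
  have hs2 : -2 < s := by linarith
  have hu : s ^ 2 + d ^ 2 = 2 * (α ^ 2 + β ^ 2) := by rw [hs, hd]; ring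
  -- This is nonpositivity of the defect at `n = 1`, where `t = s + 4`; by monotonicity it suffices.
  have key : s ^ 2 * d ^ 2 ≤ (s ^ 2 + d ^ 2 - 1) * (s + 4) ^ 2 := by
    by_cases hmax : 1 ≤ |α| + |β|
    · rw [← max_abs_add_abs_sub, le_max_iff] at hmax
      have hor : 1 ≤ s ^ 2 ∨ 1 ≤ d ^ 2 := hmax.imp
        (fun h => by rw [← sq_abs]; nlinarith) (fun h => by rw [← sq_abs]; nlinarith)
      have ht4 : 4 ≤ (s + 4) ^ 2 := by nlinarith
      have hts : s ^ 2 ≤ (s + 4) ^ 2 := by nlinarith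
      have hu0 : 0 ≤ s ^ 2 + d ^ 2 - 1 := by
        rcases hor with h | h <;> nlinarith [sq_nonneg s, sq_nonneg d]
      rcases le_or_gt 1 (s ^ 2) with h1 | h1
      · calc s ^ 2 * d ^ 2 ≤ s ^ 2 * (s ^ 2 + d ^ 2 - 1) := by gcongr; linarith
          _ ≤ (s + 4) ^ 2 * (s ^ 2 + d ^ 2 - 1) := by gcongr
          _ = _ := mul_comm _ _
      · have h2 : 1 ≤ d ^ 2 := hor.resolve_left (not_le.2 h1)
        have h3 : s ^ 2 * d ^ 2 ≤ s ^ 2 + d ^ 2 - 1 := by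
          nlinarith [mul_nonneg (sub_nonneg.2 h1.le) (sub_nonneg.2 h2)]
        nlinarith
    · have h3 := h.resolve_left hmax
      rw [← max_abs_add_abs_sub, not_le, max_lt_iff, abs_lt, abs_lt] at hmax
      -- With `u = s² + d² - 1 > 7 - 4√3 > 0.04`, one has `s²d² = s²u + s²(1 - s²) ≤ s²u + 1/4`.
      -- Since `s > -1`, `(s + 4)² - s² ≥ 8`, and `8u > 0.32` exceeds `1/4`.
      have hsq : Real.sqrt 3 < 1.74 := by
        rw [Real.sqrt_lt' (by norm_num)]; norm_num
      have hu1 : 0.04 < s ^ 2 + d ^ 2 - 1 := by rw [hu]; linarith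
      have hs1 : s ^ 2 ≤ 1 := by nlinarith [hmax.1.1, hmax.1.2]
      have hlow : s ^ 2 * (1 - s ^ 2) ≤ 1 / 4 := by nlinarith [sq_nonneg (s ^ 2 - 1 / 2)]
      have hlin : 8 ≤ (s + 4) ^ 2 - s ^ 2 := by nlinarith [hmax.1.1]
      have := mul_le_mul_of_nonneg_left hlin (by linarith : 0 ≤ s ^ 2 + d ^ 2 - 1)
      nlinarith
  unfold ratioDefect
  have e : 2 * ((1 : ℕ) : ℝ) + s + 2 = s + 4 := by push_cast; ring
  rw [← hs, ← hd, e]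
  linarith

end WidomRatio

/-! ### The Jacobi measure and its support. -/

section JacobiMeasure

variable {α β : ℝ}

/-- The normalized Jacobi measure as a measure on the real line. -/
noncomputable def realJacobiMeasure (α β : ℝ) : Measure ℝ :=
  (volume.restrict (Set.Icc (-1 : ℝ) 1)).withDensity
    (fun x => ENNReal.ofReal (jacobiNormalization α β * jacobiWeight α β x))

theorem jacobiMeasure_eq_map (α β : ℝ) :
    jacobiMeasure α β = (realJacobiMeasure α β).map (fun x : ℝ => (x : ℂ)) := rfl

theorem measurable_jacobiWeight (α β : ℝ) : Measurable (jacobiWeight α β) := by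
  unfold jacobiWeight
  fun_prop

theorem jacobiWeight_pos {x : ℝ} (hx : x ∈ Set.Ioo (-1 : ℝ) 1) : 0 < jacobiWeight α β x :=
  mul_pos (Real.rpow_pos_of_pos (sub_pos.2 hx.2) _)
    (Real.rpow_pos_of_pos (by linarith [hx.1]) _)

theorem jacobiWeight_nonneg {x : ℝ} (hx : x ∈ Set.Icc (-1 : ℝ) 1) : 0 ≤ jacobiWeight α β x :=
  mul_nonneg (Real.rpow_nonneg (sub_nonneg.2 hx.2) _)
    (Real.rpow_nonneg (by linarith [hx.1]) _)

theorem jacobiNormalization_pos (hα : -1 < α) (hβ : -1 < β) : 0 < jacobiNormalization α β := by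
  rw [jacobiNormalization, integral_Icc_eq_integral_Ioc,
    ← intervalIntegral.integral_of_le (by norm_num)]
  exact inv_pos.2 (integral_jacobiWeight_pos hα hβ)

theorem ae_restrict_mem_Ioo : ∀ᵐ x ∂(volume.restrict (Set.Icc (-1 : ℝ) 1)),
    x ∈ Set.Ioo (-1 : ℝ) 1 := by
  rw [← restrict_Ioo_eq_restrict_Icc]
  exact ae_restrict_mem measurableSet_Ioo

theorem realJacobiMeasure_ae_mem : ∀ᵐ x ∂(realJacobiMeasure α β), x ∈ Set.Icc (-1 : ℝ) 1 :=
  (withDensity_absolutelyContinuous _ _).ae_le (ae_restrict_mem measurableSet_Icc)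

theorem isFiniteMeasure_realJacobiMeasure (hα : -1 < α) (hβ : -1 < β) :
    IsFiniteMeasure (realJacobiMeasure α β) := by
  refine isFiniteMeasure_withDensity_ofReal ?_
  have h := (intervalIntegrable_jacobiWeight hα hβ).const_mul (jacobiNormalization α β)
  rw [intervalIntegrable_iff_integrableOn_Icc_of_le (by norm_num)] at h
  exact h.2

theorem integral_realJacobiMeasure (hα : -1 < α) (hβ : -1 < β) (g : ℝ → ℝ) :
    ∫ x, g x ∂(realJacobiMeasure α β)
      = jacobiNormalization α β * ∫ x in (-1 : ℝ)..1, g x * jacobiWeight α β x := by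
  rw [realJacobiMeasure, integral_withDensity_eq_integral_toReal_smul
    ((measurable_jacobiWeight α β).const_mul _).ennreal_ofReal (by simp),
    intervalIntegral.integral_of_le (by norm_num), ← integral_Icc_eq_integral_Ioc,
    ← integral_const_mul]
  refine setIntegral_congr_fun measurableSet_Icc fun x hx => ?_
  simp only [smul_eq_mul]
  rw [ENNReal.toReal_ofReal (mul_nonneg (jacobiNormalization_pos hα hβ).le
    (jacobiWeight_nonneg hx))]
  ring

theorem support_jacobiMeasure (hα : -1 < α) (hβ : -1 < β) :
    (jacobiMeasure α β).support = unitSegment := by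
  refine Set.Subset.antisymm ?_ ?_
  · refine Measure.support_subset_of_isClosed isClosed_unitSegment ?_
    exact map_ofReal_compl_unitSegment realJacobiMeasure_ae_mem
  · rintro _ ⟨x, hx, rfl⟩
    rw [Measure.mem_support_iff_forall]
    intro U hU
    rw [pos_iff_ne_zero, jacobiMeasure_eq_map, measurableEmbedding_ofReal.map_apply]
    intro h0
    have hV : (fun x : ℝ => (x : ℂ)) ⁻¹' U ∈ 𝓝 x := Complex.continuous_ofReal.continuousAt hU
    obtain ⟨V, hVU, hVo, hxV⟩ := mem_nhds_iff.1 hV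
    -- The density is positive on the open interval, so a neighbourhood null for the Jacobi measure
    -- would be Lebesgue null there.
    have hac : volume.restrict (Set.Icc (-1 : ℝ) 1) ≪ realJacobiMeasure α β := by
      refine withDensity_absolutelyContinuous'
        ((measurable_jacobiWeight α β).const_mul _).ennreal_ofReal.aemeasurable ?_
      filter_upwards [ae_restrict_mem_Ioo] with y hy
      exact (ENNReal.ofReal_pos.2 (mul_pos (jacobiNormalization_pos hα hβ)
        (jacobiWeight_pos hy))).ne'
    have h1 := hac (measure_mono_null hVU h0)
    rw [Measure.restrict_apply hVo.measurableSet] at h1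
    have hne : (V ∩ Set.Ioo (-1 : ℝ) 1).Nonempty := by
      have hcl : x ∈ closure (Set.Ioo (-1 : ℝ) 1) := by
        rwa [closure_Ioo (by norm_num)]
      exact mem_closure_iff.1 hcl V hVo hxV
    exact ((hVo.inter isOpen_Ioo).measure_pos volume hne).ne'
      (measure_mono_null (Set.inter_subset_inter_right V Set.Ioo_subset_Icc_self) h1)

end JacobiMeasure

/-! ### The entropy of the Jacobi measure. -/

section Entropy

variable {α β : ℝ}

/-- The density of the Jacobi measure with respect to the arcsine distribution. -/
noncomputable def arcsineDensity (α β x : ℝ) : ℝ :=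
  jacobiNormalization α β * Real.pi * ((1 - x) ^ (α + 1 / 2) * (1 + x) ^ (β + 1 / 2))

theorem measurable_arcsineDensity (α β : ℝ) : Measurable (arcsineDensity α β) := by
  unfold arcsineDensity
  fun_prop

theorem realJacobiMeasure_eq_withDensity (hα : -1 < α) (hβ : -1 < β) :
    realJacobiMeasure α β
      = arcsine.withDensity (fun x => ENNReal.ofReal (arcsineDensity α β x)) := by
  have hm : Measurable fun x : ℝ =>
      (ENNReal.ofNNReal (.mk (√(1 - x ^ 2)⁻¹) (by positivity))) := by fun_prop
  rw [arcsine, Chebyshev.measureT, restrict_withDensity measurableSet_Ioc,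
    withDensity_smul_measure, ← withDensity_mul _ hm (measurable_arcsineDensity α β).ennreal_ofReal,
    ← withDensity_smul _ (hm.mul (measurable_arcsineDensity α β).ennreal_ofReal),
    restrict_Ioc_eq_restrict_Icc, realJacobiMeasure]
  refine withDensity_congr_ae ?_
  filter_upwards [ae_restrict_mem_Ioo] with x hx
  have h1 : 0 < 1 - x := sub_pos.2 hx.2
  have h2 : 0 < 1 + x := by linarith [hx.1]
  have hc := jacobiNormalization_pos hα hβ
  have e : (ENNReal.ofNNReal (.mk (√(1 - x ^ 2)⁻¹) (by positivity)))
      = ENNReal.ofReal (√(1 - x ^ 2)⁻¹) := by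
    rw [ENNReal.ofReal_eq_coe_nnreal]
  simp only [Pi.smul_apply, Pi.mul_apply, smul_eq_mul]
  rw [e, ← ENNReal.ofReal_mul (by positivity), ← ENNReal.ofReal_mul (by positivity)]
  congr 1
  rw [show 1 - x ^ 2 = (1 - x) * (1 + x) by ring, arcsineDensity, jacobiWeight,
    Real.rpow_add h1, Real.rpow_add h2, ← Real.sqrt_eq_rpow, ← Real.sqrt_eq_rpow,
    Real.sqrt_inv, Real.sqrt_mul h1.le]
  have := (Real.sqrt_pos.2 h1).ne'
  have := (Real.sqrt_pos.2 h2).ne'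
  have := Real.pi_ne_zero
  field_simp

theorem extIntegral_map {X Y : Type*} [MeasurableSpace X] [MeasurableSpace Y] {f : X → Y}
    (hf : MeasurableEmbedding f) (ν : Measure X) (g : Y → EReal) :
    extIntegral (ν.map f) g = extIntegral ν (g ∘ f) := by
  simp only [extIntegral, hf.lintegral_map, Function.comp_apply]

/-- The logarithm of the density is a constant plus multiples of `log |x - 1|` and `log |x + 1|`,
each of arcsine integral `-log 2`. It is integrable, so the value `-∞` does not arise. -/
theorem entropyExp_jacobiMeasure (hα : -1 < α) (hβ : -1 < β) :
    entropyExp (jacobiMeasure α β)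
      = jacobiNormalization α β * (Real.pi / 2 ^ (α + β + 1)) := by
  have hc := jacobiNormalization_pos hα hβ
  have := isFiniteMeasure_realJacobiMeasure hα hβ
  have hrn : ∀ᵐ x : ℝ ∂arcsine, (jacobiMeasure α β).rnDeriv complexArcsine (x : ℂ)
      = ENNReal.ofReal (arcsineDensity α β x) := by
    have h1 := measurableEmbedding_ofReal.rnDeriv_map (realJacobiMeasure α β) arcsine
    have h2 := Measure.rnDeriv_withDensity arcsine (measurable_arcsineDensity α β).ennreal_ofReal
    rw [← realJacobiMeasure_eq_withDensity hα hβ] at h2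
    exact h1.trans h2
  have i1 : Integrable (fun x => Real.log |x - 1|) arcsine :=
    integrable_log_abs_sub_arcsine (by norm_num)
  have i2 : Integrable (fun x => Real.log |x - -1|) arcsine :=
    integrable_log_abs_sub_arcsine (by norm_num)
  have j1 := integral_log_abs_sub_arcsine (y := 1) (by norm_num)
  have j2 := integral_log_abs_sub_arcsine (y := -1) (by norm_num)
  have hlog : ∀ᵐ x : ℝ ∂arcsine, ENNReal.log ((jacobiMeasure α β).rnDeriv complexArcsine (x : ℂ))
      = ((Real.log (jacobiNormalization α β * Real.pi) + (α + 1 / 2) * Real.log |x - 1| +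
          (β + 1 / 2) * Real.log |x - -1| : ℝ) : EReal) := by
    filter_upwards [hrn, arcsine_ae_mem] with x hx hmem
    have h1 : 0 < 1 - x := sub_pos.2 hmem.2
    have h2 : 0 < 1 + x := by linarith [hmem.1]
    have hpi := Real.pi_pos
    rw [hx, arcsineDensity, ENNReal.log_ofReal_of_pos (by positivity),
      Real.log_mul (by positivity) (by positivity),
      Real.log_mul (x := (1 - x) ^ _) (by positivity) (by positivity),
      Real.log_rpow h1, Real.log_rpow h2, abs_sub_comm, abs_of_pos h1, sub_neg_eq_add, add_comm x 1,
      abs_of_pos h2, add_assoc]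
  rw [entropyExp, support_jacobiMeasure hα hβ, equilibriumMeasure_unitSegment]
  conv_lhs => enter [1, 1, 1]; rw [complexArcsine]
  rw [extIntegral_map measurableEmbedding_ofReal, Function.comp_def, extIntegral_congr_ae hlog,
    extIntegral_coe (by exact ((integrable_const _).add (i1.const_mul _)).add (i2.const_mul _)),
    integral_add (by exact (integrable_const _).add (i1.const_mul _)) (i2.const_mul _),
    integral_add (integrable_const _) (i1.const_mul _), integral_const_mul, integral_const_mul,
    j1, j2, EReal.exp_coe, ENNReal.toReal_ofReal (Real.exp_pos _).le]
  simp only [integral_const, probReal_univ, one_smul]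
  rw [show Real.log (jacobiNormalization α β * Real.pi) + (α + 1 / 2) * -Real.log 2 +
      (β + 1 / 2) * -Real.log 2
      = Real.log (jacobiNormalization α β * Real.pi) - Real.log 2 * (α + β + 1) by ring,
    Real.exp_sub, Real.exp_log (mul_pos hc Real.pi_pos), Real.rpow_def_of_pos two_pos, mul_div_assoc]

theorem entropyExp_jacobiMeasure_pos (hα : -1 < α) (hβ : -1 < β) :
    0 < entropyExp (jacobiMeasure α β) := by
  rw [entropyExp_jacobiMeasure hα hβ]
  have := jacobiNormalization_pos hα hβ
  have := Real.pi_pos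
  positivity

end Entropy

/-! ### Widom factors of the Jacobi measure. -/

section WidomFactor

variable {α β : ℝ}

theorem eLpNorm_two_eval_jacobiMeasure (hα : -1 < α) (hβ : -1 < β) (P : ℂ[X]) :
    (eLpNorm (fun z => P.eval z) 2 (jacobiMeasure α β)).toReal
      = √(jacobiNormalization α β *
          ∫ x in (-1 : ℝ)..1, ‖P.eval (x : ℂ)‖ ^ 2 * jacobiWeight α β x) := by
  have := isFiniteMeasure_realJacobiMeasure hα hβ
  obtain ⟨C, hC⟩ := isCompact_Icc.exists_bound_of_continuousOn (s := Set.Icc (-1 : ℝ) 1)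
    (f := fun x : ℝ => P.eval (x : ℂ)) (by fun_prop)
  have hmem : MemLp (fun x : ℝ => P.eval (x : ℂ)) 2 (realJacobiMeasure α β) :=
    MemLp.of_bound (by fun_prop) C (realJacobiMeasure_ae_mem.mono hC)
  have hn : 0 ≤ ∫ x, ‖P.eval (x : ℂ)‖ ^ (2 : ℝ) ∂(realJacobiMeasure α β) :=
    integral_nonneg fun x => by positivity
  rw [jacobiMeasure_eq_map, measurableEmbedding_ofReal.eLpNorm_map_measure]
  simp only [Function.comp_def]
  rw [hmem.eLpNorm_eq_integral_rpow_norm two_ne_zero ENNReal.ofNat_ne_top, ENNReal.toReal_ofNat,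
    ENNReal.toReal_ofReal (Real.rpow_nonneg hn _), ← one_div, ← Real.sqrt_eq_rpow,
    integral_realJacobiMeasure hα hβ]
  simp only [Real.rpow_two]

/-- Reduces complex competitors to real ones: on the real line the real part is again a monic
polynomial of the same degree, and it is no larger in modulus. -/
theorem exists_monic_eval_eq_re {P : ℂ[X]} (hP : P.Monic) :
    ∃ f : ℝ[X], f.Monic ∧ f.natDegree = P.natDegree ∧
      ∀ x : ℝ, f.eval x = (P.eval (x : ℂ)).re := by
  set f : ℝ[X] := ∑ i ∈ Finset.range (P.natDegree + 1), C (P.coeff i).re * X ^ i with hf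
  have hdeg : f.natDegree ≤ P.natDegree :=
    natDegree_sum_le_of_forall_le _ _ fun i hi =>
      (natDegree_C_mul_X_pow_le _ _).trans (Nat.lt_succ_iff.1 (Finset.mem_range.1 hi))
  have hco : f.coeff P.natDegree = 1 := by
    simp [hf, coeff_C_mul, coeff_X_pow, hP.coeff_natDegree]
  refine ⟨f, monic_of_natDegree_le_of_coeff_eq_one _ hdeg hco,
    natDegree_eq_of_le_of_coeff_ne_zero hdeg (by rw [hco]; exact one_ne_zero), fun x => ?_⟩
  rw [eval_eq_sum_range (p := P), Complex.re_sum, hf, eval_finsetSum]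
  refine Finset.sum_congr rfl fun i _ => ?_
  rw [← Complex.ofReal_pow, Complex.re_mul_ofReal]
  simp

theorem iInf_eLpNorm_jacobiMeasure (hα : -1 < α) (hβ : -1 < β) (n : ℕ) :
    (⨅ P : {P : ℂ[X] // P.Monic ∧ P.natDegree = n},
      (eLpNorm (fun z => P.1.eval z) 2 (jacobiMeasure α β)).toReal)
      = √(jacobiNormalization α β * jacobiSqNorm n α β) := by
  have hc := jacobiNormalization_pos hα hβ
  obtain ⟨p, hp, hpn, hpi⟩ := exists_integral_eq_jacobiSqNorm hα hβ n
  have hp' : (p.map Complex.ofRealHom).Monic ∧ (p.map Complex.ofRealHom).natDegree = n :=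
    ⟨hp.map _, by rw [hp.natDegree_map, hpn]⟩
  have : Nonempty {P : ℂ[X] // P.Monic ∧ P.natDegree = n} := ⟨⟨_, hp'⟩⟩
  refine le_antisymm ?_ (le_ciInf fun P => ?_)
  · refine (ciInf_le ⟨0, ?_⟩ ⟨_, hp'⟩).trans_eq ?_
    · rintro _ ⟨P, rfl⟩
      exact ENNReal.toReal_nonneg
    · rw [eLpNorm_two_eval_jacobiMeasure hα hβ, ← hpi]
      have e : ∀ x : ℝ, ‖(p.map Complex.ofRealHom).eval (x : ℂ)‖ ^ 2 = p.eval x ^ 2 := fun x => by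
        rw [show (x : ℂ) = Complex.ofRealHom x from rfl, eval_map_apply]
        simp
      simp only [e]
  · obtain ⟨f, hf, hfn, hfP⟩ := exists_monic_eval_eq_re P.2.1
    rw [eLpNorm_two_eval_jacobiMeasure hα hβ]
    refine Real.sqrt_le_sqrt (mul_le_mul_of_nonneg_left ?_ hc.le)
    refine (jacobiSqNorm_le_integral hα hβ hf (hfn.trans P.2.2)).trans ?_
    refine intervalIntegral.integral_mono_on (by norm_num)
      (intervalIntegrable_mul_jacobiWeight hα hβ (by fun_prop))
      (intervalIntegrable_mul_jacobiWeight hα hβ (by fun_prop)) fun x hx => ?_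
    refine mul_le_mul_of_nonneg_right ?_ (jacobiWeight_nonneg hx)
    rw [hfP, ← sq_abs]
    exact pow_le_pow_left₀ (abs_nonneg _) (Complex.abs_re_le_norm _) 2

theorem widomFactor_jacobiMeasure_sq (hα : -1 < α) (hβ : -1 < β) {n : ℕ} (hn : 1 ≤ n) :
    widomFactor 2 n (jacobiMeasure α β) ^ 2
      = widomRatio α β n * entropyExp (jacobiMeasure α β) := by
  have hc := jacobiNormalization_pos hα hβ
  have hpi := Real.pi_pos
  have hk := four_pow_mul_jacobiSqNorm hα hβ hn
  have hpos : 0 ≤ jacobiSqNorm n α β := by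
    have h := widomRatio_pos hα hβ hn
    refine (pos_of_mul_pos_right (a := (4 : ℝ) ^ n) ?_ (by positivity)).le
    rw [hk]
    positivity
  rw [widomFactor, support_jacobiMeasure hα hβ, capacity_unitSegment,
    iInf_eLpNorm_jacobiMeasure hα hβ, div_pow, Real.sq_sqrt (by positivity),
    entropyExp_jacobiMeasure hα hβ, mul_left_comm, ← hk, ← pow_mul, mul_comm n 2, pow_mul]
  norm_num
  field_simp
  rw [mul_assoc, ← mul_pow]
  norm_num

theorem mul_entropyExp_le_widomFactor_sq_iff (hα : -1 < α) (hβ : -1 < β) {n : ℕ} (hn : 1 ≤ n)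
    (C : ℝ) :
    C * entropyExp (jacobiMeasure α β) ≤ widomFactor 2 n (jacobiMeasure α β) ^ 2 ↔
      C ≤ widomRatio α β n := by
  rw [widomFactor_jacobiMeasure_sq hα hβ hn,
    mul_le_mul_iff_left₀ (entropyExp_jacobiMeasure_pos hα hβ)]

end WidomFactor

end Widom

theorem theorem4p1 (α β : ℝ) (hα : -1 < α) (hβ : -1 < β) :
    -- the lower bound
    (∀ n : ℕ, 1 ≤ n →
      Widom.jacobiL α β * Widom.entropyExp (Widom.jacobiMeasure α β)
        ≤ Widom.widomFactor 2 n (Widom.jacobiMeasure α β) ^ 2) ∧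
    -- optimality of the constant
    (∀ C : ℝ, (∀ n : ℕ, 1 ≤ n →
      C * Widom.entropyExp (Widom.jacobiMeasure α β)
        ≤ Widom.widomFactor 2 n (Widom.jacobiMeasure α β) ^ 2) → C ≤ Widom.jacobiL α β) ∧
    (α ^ 2 + β ^ 2 ≤ 1 / 2 → |α| + |β| < 1 → Widom.jacobiL α β < 2) ∧
    ((1 ≤ |α| + |β| ∨ 4 - 2 * Real.sqrt 3 < α ^ 2 + β ^ 2) →
      Widom.jacobiL α β = 2 ∧
      ∀ n : ℕ, 1 ≤ n →
        2 * Widom.entropyExp (Widom.jacobiMeasure α β)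
          ≤ Widom.widomFactor 2 n (Widom.jacobiMeasure α β) ^ 2) ∧
    -- the symmetric case
    (α = β →
      ((∀ n : ℕ, 1 ≤ n →
        2 * Widom.entropyExp (Widom.jacobiMeasure α β)
          ≤ Widom.widomFactor 2 n (Widom.jacobiMeasure α β) ^ 2) ↔ 1 / 2 ≤ |α|)) := by
  have lower : ∀ n : ℕ, 1 ≤ n →
      Widom.jacobiL α β * Widom.entropyExp (Widom.jacobiMeasure α β)
        ≤ Widom.widomFactor 2 n (Widom.jacobiMeasure α β) ^ 2 := fun n hn =>
    (Widom.mul_entropyExp_le_widomFactor_sq_iff hα hβ hn _).2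
      (Widom.jacobiL_le_widomRatio hα hβ hn)
  have optimal : ∀ C : ℝ, (∀ n : ℕ, 1 ≤ n →
      C * Widom.entropyExp (Widom.jacobiMeasure α β)
        ≤ Widom.widomFactor 2 n (Widom.jacobiMeasure α β) ^ 2) → C ≤ Widom.jacobiL α β :=
    fun C h => Widom.le_jacobiL hα hβ fun n hn =>
      (Widom.mul_entropyExp_le_widomFactor_sq_iff hα hβ hn C).1 (h n hn)
  have equal_two : (1 ≤ |α| + |β| ∨ 4 - 2 * Real.sqrt 3 < α ^ 2 + β ^ 2) →
      Widom.jacobiL α β = 2 ∧ ∀ n : ℕ, 1 ≤ n →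
        2 * Widom.entropyExp (Widom.jacobiMeasure α β)
          ≤ Widom.widomFactor 2 n (Widom.jacobiMeasure α β) ^ 2 := fun h => by
    have h2 := Widom.jacobiL_eq_two hα hβ h
    exact ⟨h2, fun n hn => h2 ▸ lower n hn⟩
  refine ⟨lower, optimal, Widom.jacobiL_lt_two hα hβ, equal_two, ?_⟩
  rintro rfl
  refine ⟨fun h => ?_, fun h => (equal_two (Or.inl (by linarith))).2⟩
  by_contra hlt
  rw [not_le] at hlt
  have hsq : α ^ 2 < 1 / 4 := by
    rw [← sq_abs]
    nlinarith [abs_nonneg α]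
  -- If `|α| < 1/2`, then `2α² ≤ 1/2` and `2|α| < 1`, so the optimal constant is below 2, against
  -- optimality at `C = 2`.
  exact absurd (optimal 2 h)
    (not_le.2 (Widom.jacobiL_lt_two hα hβ (by linarith) (by linarith)))
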